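/- Let $k \ge 2$ be an integer. A partition of $n$ has a $k$-sequence if, for some $a$, all of the $k$ consecutive integers $a, a+1, \dots, a+k-1$ occur among its parts. Let $p_k(n)$ be the number of partitions of $n$ with no $k$-sequence, and let $G_k(q) = \sum_{n=0}^{\infty} p_k(n) q^n$. Then the series $G_k(e^{-s})$ converges for every real $s > 0$, and $$G_k(e^{-s}) = \frac{1}{k} \exp\left( \frac{\pi^2}{6s}\left(1 - \frac{2}{k(k+1)}\right) + O_k\left(s^{\frac{1}{2k+3}}\right) \right)$$ as $s \to 0^+$ through real values, where the implied constant depends only on $k$. -/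

import Mathlib

open Filter Topology Asymptotics

/-- The partition `p` has a `k`-sequence: for some `a`, all of the `k` consecutive sizes
`a, a + 1, …, a + k - 1` occur as parts of `p`. -/
def Nat.Partition.HasKSequence {n : ℕ} (p : n.Partition) (k : ℕ) : Prop :=
  ∃ a : ℕ, ∀ i < k, a + i ∈ p.parts

/-- `p_k(n)`: the number of partitions of `n` with no `k`-sequence. -/
noncomputable def numPartitionsNoKSeq (k n : ℕ) : ℕ :=
  Nat.card {p : n.Partition // ¬ p.HasKSequence k}

/-- `G_k(q) = ∑_{n ≥ 0} p_k(n) q ^ n`, as a function of a real number `q`. -/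
noncomputable def genFunNoKSeq (k : ℕ) (q : ℝ) : ℝ :=
  ∑' n : ℕ, (numPartitionsNoKSeq k n : ℝ) * q ^ n

/-!
Write `q = e^{-s}`. Give a part of size `n`, present with some multiplicity, the weight
`w_n = q^n / (1 - q^n) = 1 / (e^{ns} - 1)`. Let `u_n` be the generating function of the partitions
without `k`-sequence all of whose parts exceed `n`. Looking at the first size above `n` that is
missing gives `u_n = ∑_{i < k} w_{n+1} ⋯ w_{n+i} u_{n+i+1}` (`runFreeGenFun_eq_sum`). Put
`d_n = u_n w_1 ⋯ w_n / Z`, where `Z` is the generating function of all partitions. Then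
`d_n = ∑_{j=1}^k (e^{(n+j)s} - 1) d_{n+j}` and `d_n e^{s n (n+1) / 2} → 1` as `n → ∞`
(`isRecSol_of_partWeight`). The generating function wanted is `Z d_0`. For `k = 1` only the empty
partition is counted, so the corresponding solution has `d_0 = 1 / Z`. It is therefore enough to
know `d_0` asymptotically for every `k ≥ 1` (`IsRecSol.log_zero`), namely
`d_0 = (1 / k) √(2π / s) exp (-π² / (3 k (k+1) s) + o(1))`, and to divide the result for `k` by the
result for `1`.

The coefficients of the recurrence vary slowly, and it is solved approximately by the WKB method.
For `y > 0` let `ℓ(y)` be the solution of `(e^y - 1) ∑_{j=1}^k e^{-jℓ} = 1`, let `S' = ℓ`, and let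
`M₁(ℓ) = ∑_{j=1}^k j e^{-jℓ}`. Then `E(y) = e^{-S(y)/s} / √M₁(ℓ(y))`, at `y = ns`, satisfies the
recurrence for `(e^{ns} - 1) d_n` with relative error `O(1 / n²)` at the `n`-th site, uniformly in
`s ≤ 1` (`logApprox_residual`); this rests on `|ℓ''| = O(1 / y²)` and the same bound for
`(log M₁(ℓ))''`. The coefficients being nonnegative, comparison from infinity downwards shows
`(e^{ns} - 1) d_n = E(ns) e^{O(1/n)}` (`IsRecSol.compare`).

The constant `S(0) = π² / (3 k (k+1))` comes from the inverse function
`y(ℓ) = log ((1 - e^{(k+1)ℓ}) / (1 - e^{kℓ}))` of `ℓ`: the symmetry `y(-ℓ) = y(ℓ) - ℓ` reduces it to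
twice the integral of `y` over `(-∞, 0]`, which is `ζ(2) (1 / k - 1 / (k+1))`
(`ratePotential_eq_dilog`, `ratePotential_add_neg`).

The approximation is no longer sharp at bounded `n`. There the longest step of the recurrence
dominates, so `d_0 ≈ (ks)^m m! d_{km}` (`IsRecSol.zero_bounds`), and Stirling's formula matches this
with the behaviour of `E` at `y = kms → 0`. The total error is `O(1 / m + m e^{ℓ(kms)})` with
`e^{ℓ(y)} = O(y^{1/k})`, and `m ≍ s^{-1/(2k+3)}` makes it `O(s^{1/(2k+3)})`.
-/

/-! ### Exponential moments -/

/-- The exponential moment `∑_{j=1}^k j ^ r e^{-jx}`. -/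
noncomputable def expMoment (k r : ℕ) (x : ℝ) : ℝ :=
  ∑ j ∈ Finset.Icc 1 k, (j : ℝ) ^ r * Real.exp (-(j * x))

lemma hasDerivAt_expMoment (k r : ℕ) (x : ℝ) :
    HasDerivAt (expMoment k r) (-expMoment k (r + 1) x) x := by
  unfold expMoment
  rw [← Finset.sum_neg_distrib]
  refine HasDerivAt.fun_sum fun j _ => ?_
  have h : HasDerivAt (fun x : ℝ => -((j : ℝ) * x)) (-((j : ℝ) * 1)) x :=
    ((hasDerivAt_id x).const_mul (j : ℝ)).neg
  refine (h.exp.const_mul ((j : ℝ) ^ r)).congr_deriv ?_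
  ring

lemma expMoment_pos {k : ℕ} (hk : 1 ≤ k) (r : ℕ) (x : ℝ) : 0 < expMoment k r x := by
  refine Finset.sum_pos (fun j hj => ?_) ⟨1, by simp [hk]⟩
  have : (0 : ℝ) < j := by exact_mod_cast (Finset.mem_Icc.1 hj).1
  positivity

lemma expMoment_succ_le (k r : ℕ) (x : ℝ) :
    expMoment k (r + 1) x ≤ k * expMoment k r x := by
  unfold expMoment
  rw [Finset.mul_sum]
  refine Finset.sum_le_sum fun j hj => ?_
  have h : (j : ℝ) ≤ k := by exact_mod_cast (Finset.mem_Icc.1 hj).2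
  rw [pow_succ]
  have := mul_le_mul_of_nonneg_right h (show 0 ≤ (j : ℝ) ^ r * Real.exp (-(j * x)) by positivity)
  nlinarith

lemma expMoment_zero_le (k r : ℕ) (x : ℝ) : expMoment k 0 x ≤ expMoment k r x := by
  refine Finset.sum_le_sum fun j hj => ?_
  have h : (1 : ℝ) ≤ j := by exact_mod_cast (Finset.mem_Icc.1 hj).1
  have := one_le_pow₀ h (n := r)
  gcongr
  simp

lemma exp_neg_mul_le_expMoment {k j : ℕ} (hj : j ∈ Finset.Icc 1 k) (x : ℝ) :
    Real.exp (-(j * x)) ≤ expMoment k 0 x := by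
  have := Finset.single_le_sum (f := fun j : ℕ => (j : ℝ) ^ 0 * Real.exp (-(j * x)))
    (fun i _ => by positivity) hj
  simpa [expMoment] using this

/-- Only the terms with `j ≥ 2` distinguish the moments, and these are of second order where the
zeroth moment is small. -/
lemma expMoment_sub_le {k : ℕ} (hk : 1 ≤ k) (r : ℕ) (x : ℝ) :
    expMoment k r x - expMoment k 0 x
      ≤ (k : ℝ) ^ r * (expMoment k 0 x * min 1 (expMoment k 0 x)) := by
  have hM := expMoment_pos hk 0 x
  have hsplit : expMoment k r x - expMoment k 0 x
      = ∑ j ∈ Finset.Icc 2 k, ((j : ℝ) ^ r - 1) * Real.exp (-(j * x)) := by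
    unfold expMoment
    rw [← Finset.sum_sub_distrib, ← Finset.add_sum_Ioc_eq_sum_Icc hk]
    simp only [Nat.cast_one, one_pow, pow_zero, sub_self, zero_add]
    refine Finset.sum_congr (by ext; simp; omega) fun j _ => by ring
  have htail : ∑ j ∈ Finset.Icc 2 k, Real.exp (-((j : ℕ) * x))
      ≤ expMoment k 0 x * min 1 (expMoment k 0 x) := by
    rw [mul_min_of_nonneg _ _ hM.le]
    refine le_min ?_ ?_
    · rw [mul_one]
      unfold expMoment
      simp only [pow_zero, one_mul]
      exact Finset.sum_le_sum_of_subset_of_nonneg (Finset.Icc_subset_Icc_left (by norm_num))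
        fun i _ _ => (Real.exp_pos _).le
    · calc ∑ j ∈ Finset.Icc 2 k, Real.exp (-((j : ℕ) * x))
          = ∑ j ∈ Finset.Icc 1 (k - 1), Real.exp (-((j : ℕ) * x)) * Real.exp (-((1 : ℕ) * x)) := by
            refine Finset.sum_bij' (fun j _ => j - 1) (fun j _ => j + 1) ?_ ?_ ?_ ?_ ?_
            · intro j hj; simp only [Finset.mem_Icc] at *; omega
            · intro j hj; simp only [Finset.mem_Icc] at *; omega
            · intro j hj; simp only [Finset.mem_Icc] at *; omega
            · intro j hj; simp only [Finset.mem_Icc] at *; omega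
            · intro j hj
              simp only [Finset.mem_Icc] at hj
              rw [← Real.exp_add]
              congr 1
              rw [Nat.cast_sub (by omega)]; push_cast; ring
        _ ≤ expMoment k 0 x * expMoment k 0 x := by
            rw [← Finset.sum_mul]
            refine mul_le_mul ?_ (exp_neg_mul_le_expMoment (by simp [hk]) x) (Real.exp_pos _).le
              hM.le
            unfold expMoment
            simp only [pow_zero, one_mul]
            exact Finset.sum_le_sum_of_subset_of_nonneg
              (Finset.Icc_subset_Icc_right (by omega)) fun i _ _ => (Real.exp_pos _).le
  rw [hsplit]
  calc _ ≤ ∑ j ∈ Finset.Icc 2 k, (k : ℝ) ^ r * Real.exp (-((j : ℕ) * x)) := by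
        refine Finset.sum_le_sum fun j hj => ?_
        have h : (j : ℝ) ≤ k := by exact_mod_cast (Finset.mem_Icc.1 hj).2
        have := pow_le_pow_left₀ (Nat.cast_nonneg j) h r
        gcongr
        linarith
    _ ≤ _ := by
        rw [← Finset.mul_sum]
        gcongr

/-- The derivative of the decay rate `ℓ(y)`, as a function of the rate: `ℓ' = M₀ (1 + M₀) / M₁`
at `ℓ`, where `M_r = expMoment k r`. -/
noncomputable def rateSpeed (k : ℕ) (x : ℝ) : ℝ :=
  expMoment k 0 x * (1 + expMoment k 0 x) / expMoment k 1 x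

/-- The derivative of `rateSpeed k`; times `rateSpeed k` it is the second derivative `ℓ''`. -/
noncomputable def rateSpeedDeriv (k : ℕ) (x : ℝ) : ℝ :=
  -(1 + 2 * expMoment k 0 x)
    + expMoment k 0 x * (1 + expMoment k 0 x) * expMoment k 2 x / expMoment k 1 x ^ 2

lemma hasDerivAt_rateSpeed {k : ℕ} (hk : 1 ≤ k) (x : ℝ) :
    HasDerivAt (rateSpeed k) (rateSpeedDeriv k x) x := by
  have h0 := hasDerivAt_expMoment k 0 x
  have h1 := hasDerivAt_expMoment k 1 x
  have hp := expMoment_pos hk 1 x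
  have := (h0.mul (h0.const_add 1)).div h1 hp.ne'
  refine this.congr_deriv ?_
  simp only [rateSpeedDeriv, Nat.reduceAdd, Pi.mul_apply]
  field_simp
  ring

lemma rateSpeed_pos {k : ℕ} (hk : 1 ≤ k) (x : ℝ) : 0 < rateSpeed k x := by
  have h0 := expMoment_pos hk 0 x
  have h1 := expMoment_pos hk 1 x
  unfold rateSpeed; positivity

lemma rateSpeed_le {k : ℕ} (hk : 1 ≤ k) (x : ℝ) : rateSpeed k x ≤ 1 + expMoment k 0 x := by
  have h0 := expMoment_pos hk 0 x
  have h1 := expMoment_pos hk 1 x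
  have h := expMoment_zero_le k 1 x
  unfold rateSpeed
  rw [div_le_iff₀ h1]
  nlinarith

lemma one_add_mul_min_le {a : ℝ} (ha : 0 ≤ a) : (1 + a) * min 1 a ≤ 2 * a := by
  rcases le_total 1 a with h | h
  · rw [min_eq_left h]; linarith
  · rw [min_eq_right h]; nlinarith

lemma sq_expMoment_le {k : ℕ} (r : ℕ) (x : ℝ) :
    expMoment k (r + 1) x ^ 2 ≤ expMoment k r x * expMoment k (r + 2) x := by
  unfold expMoment
  refine Finset.sum_sq_le_sum_mul_sum_of_sq_le_mul _ (fun _ _ => by positivity)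
    (fun _ _ => by positivity) fun j _ => le_of_eq (by ring)

lemma expMoment_le_pow_mul (k r : ℕ) (x : ℝ) :
    expMoment k r x ≤ (k : ℝ) ^ r * expMoment k 0 x := by
  induction r with
  | zero => simp
  | succ r ih =>
    refine (expMoment_succ_le k r x).trans ?_
    rw [pow_succ]
    have : (k : ℝ) * expMoment k r x ≤ k * ((k : ℝ) ^ r * expMoment k 0 x) := by gcongr
    linarith

/-- The variance-like combination `M_r M_{r+2} - M_{r+1}²` is small against `M₀²` where `M₀` is. -/
lemma expMoment_mul_sub_sq_le {k : ℕ} (hk : 1 ≤ k) (r : ℕ) (x : ℝ) :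
    expMoment k r x * expMoment k (r + 2) x - expMoment k (r + 1) x ^ 2
      ≤ (k : ℝ) ^ r * ((k : ℝ) ^ (r + 2) + 1) *
        (expMoment k 0 x ^ 2 * min 1 (expMoment k 0 x)) := by
  have hM := expMoment_pos hk 0 x
  set M := expMoment k 0 x
  set δ := min 1 M
  have hδ : 0 < δ := lt_min one_pos hM
  have h1 := expMoment_sub_le hk r x
  have h2 := expMoment_sub_le hk (r + 2) x
  have h3 := expMoment_zero_le k (r + 1) x
  have h4 := expMoment_le_pow_mul k r x
  have h5 := expMoment_zero_le k r x
  have hk' : (1 : ℝ) ≤ (k : ℝ) ^ r := one_le_pow₀ (by exact_mod_cast hk)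
  change _ ≤ (k : ℝ) ^ r * M at h4
  change M ≤ _ at h5
  change M ≤ _ at h3
  change _ - M ≤ (k : ℝ) ^ r * (M * δ) at h1
  change _ - M ≤ (k : ℝ) ^ (r + 2) * (M * δ) at h2
  have hA : expMoment k r x * expMoment k (r + 2) x
      ≤ expMoment k r x * (M + (k : ℝ) ^ (r + 2) * (M * δ)) := by
    refine mul_le_mul_of_nonneg_left (by linarith) (by linarith)
  have hB : expMoment k r x * ((k : ℝ) ^ (r + 2) * (M * δ))
      ≤ ((k : ℝ) ^ r * M) * ((k : ℝ) ^ (r + 2) * (M * δ)) := by gcongr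
  have hC : expMoment k r x * M ≤ (M + (k : ℝ) ^ r * (M * δ)) * M := by
    refine mul_le_mul_of_nonneg_right (by linarith) hM.le
  nlinarith [mul_le_mul h3 h3 hM.le (by linarith)]

/-- In `rateSpeedDeriv` the terms that do not vanish with `M₀` cancel. -/
lemma rateSpeedDeriv_bound {k : ℕ} (hk : 1 ≤ k) :
    ∃ C : ℝ, 0 < C ∧ ∀ x, |rateSpeedDeriv k x| ≤ C * expMoment k 0 x := by
  refine ⟨1 + 2 * ((k : ℝ) ^ 2 + 1), by positivity, fun x => ?_⟩
  have hM := expMoment_pos hk 0 x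
  have h1 := expMoment_pos hk 1 x
  have h01 := expMoment_zero_le k 1 x
  have hV := expMoment_mul_sub_sq_le hk 0 x
  have hV0 := sq_expMoment_le (k := k) 0 x
  have hm := one_add_mul_min_le hM.le
  simp only [zero_add, pow_zero, one_mul] at hV hV0
  set M := expMoment k 0 x
  set M1 := expMoment k 1 x
  set M2 := expMoment k 2 x
  have heq : rateSpeedDeriv k x = -M + (1 + M) * ((M * M2 - M1 ^ 2) / M1 ^ 2) := by
    change -(1 + 2 * M) + M * (1 + M) * M2 / M1 ^ 2 = _
    field_simp
    ring
  have hfrac : (M * M2 - M1 ^ 2) / M1 ^ 2 ≤ ((k : ℝ) ^ 2 + 1) * min 1 M := by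
    rw [div_le_iff₀ (by positivity)]
    have : M ^ 2 ≤ M1 ^ 2 := by gcongr
    have h0 : 0 ≤ ((k : ℝ) ^ 2 + 1) * min 1 M := by positivity
    nlinarith [mul_le_mul_of_nonneg_left this h0]
  have hfrac0 : 0 ≤ (M * M2 - M1 ^ 2) / M1 ^ 2 := div_nonneg (by linarith) (by positivity)
  have hle : (1 + M) * ((M * M2 - M1 ^ 2) / M1 ^ 2) ≤ ((k : ℝ) ^ 2 + 1) * (2 * M) := by
    calc _ ≤ (1 + M) * (((k : ℝ) ^ 2 + 1) * min 1 M) := by gcongr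
      _ = ((k : ℝ) ^ 2 + 1) * ((1 + M) * min 1 M) := by ring
      _ ≤ _ := by gcongr
  have hge : 0 ≤ (1 + M) * ((M * M2 - M1 ^ 2) / M1 ^ 2) := by positivity
  rw [heq, abs_le]
  constructor <;> nlinarith [mul_pos (show (0 : ℝ) < k ^ 2 + 1 by positivity) hM]

/-- The derivative of `-log M₁(ℓ(y))` in `y`, as a function of the rate: `M₂ ℓ' / M₁`. -/
noncomputable def ampSpeed (k : ℕ) (x : ℝ) : ℝ :=
  rateSpeed k x * (expMoment k 2 x / expMoment k 1 x)

/-- The derivative of `ampSpeed k`; times `rateSpeed k` it is the second derivative of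
`-log M₁(ℓ(y))`. -/
noncomputable def ampSpeedDeriv (k : ℕ) (x : ℝ) : ℝ :=
  rateSpeedDeriv k x * (expMoment k 2 x / expMoment k 1 x)
    - rateSpeed k x *
      ((expMoment k 1 x * expMoment k 3 x - expMoment k 2 x ^ 2) / expMoment k 1 x ^ 2)

lemma hasDerivAt_ampSpeed {k : ℕ} (hk : 1 ≤ k) (x : ℝ) :
    HasDerivAt (ampSpeed k) (ampSpeedDeriv k x) x := by
  have h1 := hasDerivAt_expMoment k 1 x
  have h2 := hasDerivAt_expMoment k 2 x
  have hp := expMoment_pos hk 1 x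
  have := (hasDerivAt_rateSpeed hk x).mul (h2.div h1 hp.ne')
  refine this.congr_deriv ?_
  simp only [ampSpeedDeriv, Nat.reduceAdd, Pi.div_apply]
  field_simp
  ring

lemma expMoment_three_frac_bound {k : ℕ} (hk : 1 ≤ k) (x : ℝ) :
    0 ≤ (expMoment k 1 x * expMoment k 3 x - expMoment k 2 x ^ 2) / expMoment k 1 x ^ 2 ∧
    (expMoment k 1 x * expMoment k 3 x - expMoment k 2 x ^ 2) / expMoment k 1 x ^ 2
      ≤ k * ((k : ℝ) ^ 3 + 1) * min 1 (expMoment k 0 x) := by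
  have hM := expMoment_pos hk 0 x
  have h1 := expMoment_pos hk 1 x
  have h01 := expMoment_zero_le k 1 x
  have hV := expMoment_mul_sub_sq_le hk 1 x
  have hV0 := sq_expMoment_le (k := k) 1 x
  simp only [pow_one, Nat.reduceAdd] at hV hV0
  refine ⟨div_nonneg (by linarith) (by positivity), ?_⟩
  rw [div_le_iff₀ (by positivity)]
  refine hV.trans ?_
  have : expMoment k 0 x ^ 2 ≤ expMoment k 1 x ^ 2 := by gcongr
  have h0 : 0 ≤ k * ((k : ℝ) ^ 3 + 1) * min 1 (expMoment k 0 x) := by positivity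
  nlinarith [mul_le_mul_of_nonneg_left this h0]

lemma expMoment_ratio_bound {k : ℕ} (hk : 1 ≤ k) (r : ℕ) (x : ℝ) :
    0 ≤ expMoment k (r + 1) x / expMoment k r x ∧
      expMoment k (r + 1) x / expMoment k r x ≤ k := by
  have h1 := expMoment_pos hk r x
  have h2 := expMoment_pos hk (r + 1) x
  refine ⟨by positivity, ?_⟩
  rw [div_le_iff₀ h1]
  exact expMoment_succ_le k r x

lemma ampSpeedDeriv_bound {k : ℕ} (hk : 1 ≤ k) :
    ∃ C : ℝ, 0 < C ∧ ∀ x, |ampSpeedDeriv k x| ≤ C * expMoment k 0 x := by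
  obtain ⟨C, hC, hb⟩ := rateSpeedDeriv_bound hk
  refine ⟨C * k + k * ((k : ℝ) ^ 3 + 1) * 2, by positivity, fun x => ?_⟩
  have hM := expMoment_pos hk 0 x
  obtain ⟨f0, f1⟩ := expMoment_three_frac_bound hk x
  obtain ⟨r0, r1⟩ := expMoment_ratio_bound hk 1 x
  have hs := rateSpeed_le hk x
  have hs0 := rateSpeed_pos hk x
  have hm := one_add_mul_min_le hM.le
  have hA : |rateSpeedDeriv k x * (expMoment k 2 x / expMoment k 1 x)|
      ≤ C * expMoment k 0 x * k := by
    rw [abs_mul, abs_of_nonneg r0]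
    gcongr
    exact hb x
  have hB : |rateSpeed k x *
      ((expMoment k 1 x * expMoment k 3 x - expMoment k 2 x ^ 2) / expMoment k 1 x ^ 2)|
      ≤ k * ((k : ℝ) ^ 3 + 1) * (2 * expMoment k 0 x) := by
    rw [abs_mul, abs_of_pos hs0, abs_of_nonneg f0]
    calc _ ≤ (1 + expMoment k 0 x) * (k * ((k : ℝ) ^ 3 + 1) * min 1 (expMoment k 0 x)) := by
          gcongr
      _ = k * ((k : ℝ) ^ 3 + 1) * ((1 + expMoment k 0 x) * min 1 (expMoment k 0 x)) := by ring
      _ ≤ _ := by gcongr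
  unfold ampSpeedDeriv
  refine (abs_sub _ _).trans ?_
  nlinarith

/-! ### The decay rate and the dilogarithm integral -/

/-- The position `y(x) = log (1 + 1 / M₀(x))` at which the local decay rate is `x`; here
`M₀ = expMoment k 0`. -/
noncomputable def rateInv (k : ℕ) (x : ℝ) : ℝ := Real.log (1 + 1 / expMoment k 0 x)

lemma exp_rateInv {k : ℕ} (hk : 1 ≤ k) (x : ℝ) :
    Real.exp (rateInv k x) = 1 + 1 / expMoment k 0 x := by
  have := expMoment_pos hk 0 x
  exact Real.exp_log (by positivity)

lemma rateInv_pos {k : ℕ} (hk : 1 ≤ k) (x : ℝ) : 0 < rateInv k x := by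
  have := expMoment_pos hk 0 x
  exact Real.log_pos (by rw [lt_add_iff_pos_right]; positivity)

lemma hasDerivAt_rateInv {k : ℕ} (hk : 1 ≤ k) (x : ℝ) :
    HasDerivAt (rateInv k) (rateSpeed k x)⁻¹ x := by
  have h0 := expMoment_pos hk 0 x
  have h1 := expMoment_pos hk 1 x
  have h := (hasDerivAt_expMoment k 0 x).fun_inv h0.ne'
  have h2 := (h.const_add 1).log (by positivity)
  unfold rateInv
  simp only [one_div]
  refine h2.congr_deriv ?_
  unfold rateSpeed
  simp only [zero_add]
  field_simp
  ring

lemma continuous_rateInv {k : ℕ} (hk : 1 ≤ k) : Continuous (rateInv k) :=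
  continuous_iff_continuousAt.2 fun x => (hasDerivAt_rateInv hk x).continuousAt

lemma strictMono_rateInv {k : ℕ} (hk : 1 ≤ k) : StrictMono (rateInv k) :=
  strictMono_of_hasDerivAt_pos (hasDerivAt_rateInv hk) fun x => inv_pos.2 (rateSpeed_pos hk x)

lemma one_add_expMoment_neg {k : ℕ} (hk : 1 ≤ k) (x : ℝ) :
    1 + expMoment k 0 (-x) = Real.exp (k * x) * (1 + expMoment k 0 x) := by
  have h : ∀ z : ℝ, 1 + expMoment k 0 z = ∑ j ∈ Finset.range (k + 1), Real.exp (-(j * z)) := by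
    intro z
    rw [Finset.range_eq_Ico, ← Finset.sum_Ioo_add_eq_sum_Ico (by omega), add_comm]
    unfold expMoment
    simp only [pow_zero, one_mul, Nat.cast_zero, zero_mul, neg_zero, Real.exp_zero]
    congr 1
  rw [h, h, Finset.mul_sum, ← Finset.sum_range_reflect]
  refine Finset.sum_congr rfl fun j hj => ?_
  rw [← Real.exp_add]
  congr 1
  have : j ≤ k := by simpa [Nat.lt_succ_iff] using hj
  rw [show k + 1 - 1 - j = k - j by omega, Nat.cast_sub this]
  ring

lemma expMoment_neg {k : ℕ} (x : ℝ) :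
    expMoment k 0 (-x) = Real.exp ((k + 1) * x) * expMoment k 0 x := by
  unfold expMoment
  rw [Finset.mul_sum]
  refine Finset.sum_bij' (fun j _ => k + 1 - j) (fun j _ => k + 1 - j) ?_ ?_ ?_ ?_ ?_
  · intro j hj; simp only [Finset.mem_Icc] at *; omega
  · intro j hj; simp only [Finset.mem_Icc] at *; omega
  · intro j hj; simp only [Finset.mem_Icc] at *; omega
  · intro j hj; simp only [Finset.mem_Icc] at *; omega
  · intro j hj
    simp only [Finset.mem_Icc] at hj
    rw [pow_zero, pow_zero, one_mul, one_mul, ← Real.exp_add, Nat.cast_sub (by omega)]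
    congr 1
    push_cast
    ring

/-- The reflection symmetry: the curve traced by `(y(x), y(x) - x)` is symmetric under exchange of
its coordinates. -/
lemma rateInv_neg {k : ℕ} (hk : 1 ≤ k) (x : ℝ) : rateInv k (-x) = rateInv k x - x := by
  have h0 := expMoment_pos hk 0 x
  have h1 := expMoment_pos hk 0 (-x)
  apply Real.exp_injective
  rw [Real.exp_sub, exp_rateInv hk, exp_rateInv hk]
  have e1 : 1 + 1 / expMoment k 0 (-x) = (1 + expMoment k 0 (-x)) / expMoment k 0 (-x) := by
    field_simp
    ring
  rw [e1, one_add_expMoment_neg hk, expMoment_neg, add_mul, one_mul, Real.exp_add]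
  field_simp
  ring

lemma rateInv_le_exp {k : ℕ} (hk : 1 ≤ k) (x : ℝ) : rateInv k x ≤ Real.exp x := by
  have h := exp_neg_mul_le_expMoment (k := k) (j := 1) (by simp [hk]) x
  have h0 := expMoment_pos hk 0 x
  calc rateInv k x ≤ 1 / expMoment k 0 x := by
        have := Real.log_le_sub_one_of_pos (x := 1 + 1 / expMoment k 0 x) (by positivity)
        unfold rateInv; linarith
    _ ≤ 1 / Real.exp (-x) := by
        refine one_div_le_one_div_of_le (Real.exp_pos _) (by simpa using h)
    _ = Real.exp x := by rw [Real.exp_neg]; simp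

lemma exists_rateInv_eq {k : ℕ} (hk : 1 ≤ k) {y : ℝ} (hy : 0 < y) : ∃ x, rateInv k x = y := by
  have h1 : rateInv k (Real.log y) ≤ y := by
    have := rateInv_le_exp hk (Real.log y)
    rwa [Real.exp_log hy] at this
  have h2 : y ≤ rateInv k y := by
    have := rateInv_neg hk y
    have := rateInv_pos hk (-y)
    linarith
  exact mem_range_of_exists_le_of_exists_ge (continuous_rateInv hk) ⟨_, h1⟩ ⟨_, h2⟩

/-- The local decay rate `ℓ(y)` at `y > 0`: the solution `x` of `(e^y - 1) ∑_{j=1}^k e^{-jx} = 1`,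
encoded as an inverse of `rateInv k`. Its values at `y ≤ 0` are meaningless and never used. -/
noncomputable def rate (k : ℕ) (y : ℝ) : ℝ := Function.invFun (rateInv k) y

lemma rateInv_rate {k : ℕ} (hk : 1 ≤ k) {y : ℝ} (hy : 0 < y) : rateInv k (rate k y) = y :=
  Function.invFun_eq (exists_rateInv_eq hk hy)

lemma rate_rateInv {k : ℕ} (hk : 1 ≤ k) (x : ℝ) : rate k (rateInv k x) = x :=
  Function.leftInverse_invFun (strictMono_rateInv hk).injective x

lemma strictMonoOn_rate {k : ℕ} (hk : 1 ≤ k) : StrictMonoOn (rate k) (Set.Ioi 0) := by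
  intro a ha b hb hab
  rw [← (strictMono_rateInv hk).lt_iff_lt, rateInv_rate hk ha, rateInv_rate hk hb]
  exact hab

lemma hasDerivAt_rate {k : ℕ} (hk : 1 ≤ k) {y : ℝ} (hy : 0 < y) :
    HasDerivAt (rate k) (rateSpeed k (rate k y)) y := by
  have himg : rate k '' Set.Ioi 0 = Set.univ :=
    Set.eq_univ_of_forall fun x => ⟨rateInv k x, rateInv_pos hk x, rate_rateInv hk x⟩
  have hc : ContinuousAt (rate k) y :=
    (strictMonoOn_rate hk).continuousAt_of_image_mem_nhds (Ioi_mem_nhds hy)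
      (by rw [himg]; exact univ_mem)
  have := HasDerivAt.of_local_left_inverse hc (hasDerivAt_rateInv hk (rate k y))
    (inv_ne_zero (rateSpeed_pos hk _).ne')
    ((eventually_gt_nhds hy).mono fun z hz => rateInv_rate hk hz)
  rwa [inv_inv] at this

lemma tendsto_rate_atTop {k : ℕ} (hk : 1 ≤ k) : Tendsto (rate k) atTop atTop := by
  refine tendsto_atTop.2 fun b => ?_
  filter_upwards [eventually_gt_atTop 0, eventually_ge_atTop (rateInv k b)] with y hy hb
  rw [← (strictMono_rateInv hk).le_iff_le, rateInv_rate hk hy]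
  exact hb

/-- The dilogarithm `∑_{n ≥ 1} z ^ n / n ^ 2`. -/
noncomputable def dilog (z : ℝ) : ℝ := ∑' n : ℕ, z ^ (n + 1) / ((n : ℝ) + 1) ^ 2

lemma hasSum_inv_succ_sq : HasSum (fun n : ℕ => 1 / ((n : ℝ) + 1) ^ 2) (Real.pi ^ 2 / 6) := by
  have h := (hasSum_nat_add_iff' (f := fun n : ℕ => 1 / (n : ℝ) ^ 2) 1).2 hasSum_zeta_two
  simpa using h

lemma dilog_one : dilog 1 = Real.pi ^ 2 / 6 := by
  unfold dilog
  simpa using hasSum_inv_succ_sq.tsum_eq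

lemma dilog_term_le {z : ℝ} (hz : z ∈ Set.Icc (0 : ℝ) 1) (n : ℕ) :
    z ^ (n + 1) / ((n : ℝ) + 1) ^ 2 ≤ z * (1 / ((n : ℝ) + 1) ^ 2) := by
  have : z ^ (n + 1) ≤ z := by
    simpa using pow_le_pow_of_le_one hz.1 hz.2 (show 1 ≤ n + 1 by omega)
  rw [mul_one_div]
  gcongr

lemma summable_dilog {z : ℝ} (hz : z ∈ Set.Icc (0 : ℝ) 1) :
    Summable fun n : ℕ => z ^ (n + 1) / ((n : ℝ) + 1) ^ 2 :=
  Summable.of_nonneg_of_le (fun n => div_nonneg (pow_nonneg hz.1 _) (by positivity))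
    (dilog_term_le hz) (hasSum_inv_succ_sq.summable.mul_left z)

lemma continuousOn_dilog : ContinuousOn dilog (Set.Icc 0 1) := by
  refine continuousOn_tsum (u := fun n : ℕ => 1 / ((n : ℝ) + 1) ^ 2)
    (fun n => by fun_prop) hasSum_inv_succ_sq.summable fun n z hz => ?_
  rw [Real.norm_of_nonneg (div_nonneg (pow_nonneg hz.1 _) (by positivity))]
  refine (dilog_term_le hz n).trans (mul_le_of_le_one_left (by positivity) hz.2)

lemma hasDerivAt_dilog {z : ℝ} (hz0 : 0 < z) (hz1 : z < 1) :
    HasDerivAt dilog (-Real.log (1 - z) / z) z := by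
  obtain ⟨r, hr0, hr1⟩ := exists_between hz1
  have hr : 0 < r := hz0.trans hr0
  have hd : HasDerivAt dilog (∑' n : ℕ, z ^ n / ((n : ℝ) + 1)) z := by
    refine hasDerivAt_tsum_of_isPreconnected (u := fun n : ℕ => r ^ n)
      (g := fun (n : ℕ) z => z ^ (n + 1) / ((n : ℝ) + 1) ^ 2) (t := Set.Ioo (-r) r) (y₀ := 0)
      (g' := fun n z => z ^ n / ((n : ℝ) + 1))
      (summable_geometric_of_lt_one hr.le hr1) isOpen_Ioo isPreconnected_Ioo ?_ ?_
      ⟨by linarith, hr⟩ ?_ ⟨by linarith, hr0⟩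
    · intro n y _
      refine ((hasDerivAt_pow (n + 1) y).div_const _).congr_deriv ?_
      push_cast
      have : ((n : ℝ) + 1) ≠ 0 := by positivity
      field_simp
    · intro n y hy
      rw [norm_div, norm_pow, Real.norm_of_nonneg (show (0 : ℝ) ≤ (n : ℝ) + 1 by positivity)]
      refine (div_le_self (by positivity) (by linarith [(Nat.cast_nonneg n : (0 : ℝ) ≤ n)])).trans ?_
      gcongr
      exact abs_le.2 ⟨hy.1.le, hy.2.le⟩
    · exact summable_dilog ⟨le_rfl, zero_le_one⟩
  have hs := Real.hasSum_pow_div_log_of_abs_lt_one (x := z) (by rwa [abs_of_pos hz0])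
  have hs2 : HasSum (fun n : ℕ => z ^ n / ((n : ℝ) + 1)) (-Real.log (1 - z) / z) := by
    refine (hs.div_const z).congr_fun fun n => ?_
    rw [pow_succ]
    field_simp
  rwa [hs2.tsum_eq] at hd

lemma le_dilog {z : ℝ} (hz : z ∈ Set.Icc (0 : ℝ) 1) : z ≤ dilog z := by
  have := (summable_dilog hz).le_tsum 0
    fun n _ => div_nonneg (pow_nonneg hz.1 _) (by positivity)
  simpa [dilog] using this

lemma dilog_le {z : ℝ} (hz : z ∈ Set.Icc (0 : ℝ) 1) : dilog z ≤ z + z ^ 2 := by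
  have h1 := (summable_dilog hz).tsum_eq_zero_add
  have h2 : ∑' n : ℕ, z ^ (n + 1 + 1) / (((n + 1 : ℕ) : ℝ) + 1) ^ 2 ≤ z ^ 2 * (Real.pi ^ 2 / 6 - 1) := by
    have h3 := (hasSum_nat_add_iff' (f := fun n : ℕ => 1 / ((n : ℝ) + 1) ^ 2) 1).2
      hasSum_inv_succ_sq
    simp only [Finset.sum_range_one, Nat.cast_zero, zero_add, one_pow, div_one] at h3
    rw [← (h3.mul_left (z ^ 2)).tsum_eq]
    refine Summable.tsum_le_tsum (fun n => ?_) ?_ (h3.mul_left (z ^ 2)).summable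
    · rw [mul_one_div]
      have : z ^ (n + 1 + 1) ≤ z ^ 2 := pow_le_pow_of_le_one hz.1 hz.2 (by omega)
      gcongr
    · exact (summable_nat_add_iff (f := fun n : ℕ => z ^ (n + 1) / ((n : ℝ) + 1) ^ 2) 1).2
        (summable_dilog hz)
  have h4 : Real.pi ^ 2 / 6 - 1 ≤ 1 := by
    nlinarith [Real.pi_lt_d2, Real.pi_pos]
  have : dilog z = z + ∑' n : ℕ, z ^ (n + 1 + 1) / (((n + 1 : ℕ) : ℝ) + 1) ^ 2 := by
    unfold dilog; rw [h1]; simp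
  nlinarith [mul_le_mul_of_nonneg_left h4 (sq_nonneg z)]

/-- The antiderivative of `rateInv k` that vanishes at `-∞`; the constant is its value at `0`, which
`ratePotential_eq_dilog` justifies. -/
noncomputable def ratePotential (k : ℕ) (x : ℝ) : ℝ :=
  Real.pi ^ 2 / (6 * (k * (k + 1))) + ∫ u in (0 : ℝ)..x, rateInv k u

lemma hasDerivAt_ratePotential {k : ℕ} (hk : 1 ≤ k) (x : ℝ) :
    HasDerivAt (ratePotential k) (rateInv k x) x := by
  have := ((continuous_rateInv hk).integral_hasStrictDerivAt 0 x).hasDerivAt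
  exact this.const_add _

lemma rateInv_eq_of_neg {k : ℕ} (hk : 1 ≤ k) {x : ℝ} (hx : x < 0) :
    rateInv k x = Real.log (1 - Real.exp ((k + 1) * x)) - Real.log (1 - Real.exp (k * x)) := by
  have hM := expMoment_pos hk 0 x
  have hkp : (0 : ℝ) < k := by exact_mod_cast hk
  have ha : Real.exp ((k + 1) * x) < 1 := Real.exp_lt_one_iff.2 (by nlinarith)
  have hb : Real.exp (k * x) < 1 := Real.exp_lt_one_iff.2 (by nlinarith)
  have h1 := one_add_expMoment_neg hk x
  rw [expMoment_neg] at h1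
  rw [← Real.log_div (by linarith) (by linarith)]
  unfold rateInv
  congr 1
  rw [eq_div_iff (by linarith)]
  set a := Real.exp ((k + 1) * x)
  set b := Real.exp (k * x)
  field_simp
  linear_combination h1

/-- Integrating `log (1 - e^{cx})` termwise gives the dilogarithm, and `dilog 1 = π² / 6` fixes the
constant of integration. -/
lemma ratePotential_eq_dilog {k : ℕ} (hk : 1 ≤ k) {x : ℝ} (hx : x ≤ 0) :
    ratePotential k x = dilog (Real.exp (k * x)) / k
      - dilog (Real.exp ((k + 1) * x)) / (k + 1) := by
  have hkp : (0 : ℝ) < k := by exact_mod_cast hk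
  set F : ℝ → ℝ := fun x => ratePotential k x - (dilog (Real.exp (k * x)) / k
      - dilog (Real.exp ((k + 1) * x)) / (k + 1)) with hF
  have hF0 : F 0 = 0 := by
    simp only [hF, ratePotential, intervalIntegral.integral_same, mul_zero, Real.exp_zero, dilog_one]
    field_simp
    ring
  suffices F x = 0 by simpa [hF, sub_eq_zero] using this
  rcases hx.eq_or_lt with rfl | hx
  · exact hF0
  have hcont : ∀ c : ℝ, 0 < c → ContinuousOn (fun x => dilog (Real.exp (c * x))) (Set.Icc x 0) := by
    intro c hc
    refine continuousOn_dilog.comp (by fun_prop) fun z hz => ⟨(Real.exp_pos _).le, ?_⟩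
    rw [Real.exp_le_one_iff]
    nlinarith [hz.2]
  have hder : ∀ c : ℝ, 0 < c → ∀ z < 0, HasDerivAt (fun x => dilog (Real.exp (c * x)) / c)
      (-Real.log (1 - Real.exp (c * z))) z := by
    intro c hc z hz
    have h := hasDerivAt_dilog (z := Real.exp (c * z)) (Real.exp_pos _)
      (Real.exp_lt_one_iff.2 (by nlinarith))
    have h2 : HasDerivAt (fun x => Real.exp (c * x)) (Real.exp (c * z) * (c * 1)) z :=
      ((hasDerivAt_id z).const_mul c).exp
    refine ((h.comp z h2).div_const c).congr_deriv ?_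
    have := Real.exp_pos (c * z)
    field_simp
  obtain ⟨c, hc, hslope⟩ := exists_hasDerivAt_eq_slope F (fun _ => 0) hx
    (((continuous_iff_continuousAt.2 fun x =>
      (hasDerivAt_ratePotential hk x).continuousAt).continuousOn).sub
      (((hcont k hkp).div_const _).sub ((hcont (k + 1) (by positivity)).div_const _))) (by
      intro z hz
      refine ((hasDerivAt_ratePotential hk z).sub ((hder k hkp z hz.2).sub
        (hder (k + 1) (by positivity) z hz.2))).congr_deriv ?_
      rw [rateInv_eq_of_neg hk hz.2]
      ring)
  rw [hF0, eq_comm, div_eq_zero_iff] at hslope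
  rcases hslope with h | h <;> linarith

/-- The integrated form of the reflection symmetry; it produces the exponent `π² / (3 k (k + 1))`. -/
lemma ratePotential_add_neg {k : ℕ} (hk : 1 ≤ k) (x : ℝ) :
    ratePotential k x + ratePotential k (-x)
      = Real.pi ^ 2 / (3 * (k * (k + 1))) + x ^ 2 / 2 := by
  have hd : ∀ x, HasDerivAt (fun x => ratePotential k x + ratePotential k (-x) - x ^ 2 / 2) 0 x := by
    intro x
    have h1 := (hasDerivAt_ratePotential hk (-x)).comp x (hasDerivAt_neg x)
    refine (((hasDerivAt_ratePotential hk x).add h1).sub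
      ((hasDerivAt_pow 2 x).div_const 2)).congr_deriv ?_
    rw [rateInv_neg hk]
    push_cast
    ring
  have h := is_const_of_deriv_eq_zero (fun x => (hd x).differentiableAt)
    (fun x => (hd x).deriv) x 0
  have h0 : ratePotential k 0 = Real.pi ^ 2 / (6 * (k * (k + 1))) := by simp [ratePotential]
  simp only [neg_zero, h0] at h
  have hkp : (0 : ℝ) < k := by exact_mod_cast hk
  have e : Real.pi ^ 2 / (6 * ((k : ℝ) * (k + 1))) * 2 = Real.pi ^ 2 / (3 * (k * (k + 1))) := by
    field_simp
    ring
  linarith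

/-- To leading order `ratePotential k x` is the integral `e^{kx} / k` of `e^{ku}` over `(-∞, x]`. -/
lemma abs_ratePotential_sub_le {k : ℕ} (hk : 1 ≤ k) {x : ℝ} (hx : x ≤ 0) :
    |ratePotential k x - Real.exp (k * x) / k| ≤ 3 * Real.exp ((k + 1) * x) := by
  have hkp : (1 : ℝ) ≤ k := by exact_mod_cast hk
  have ha : Real.exp ((k + 1) * x) ≤ 1 := Real.exp_le_one_iff.2 (by nlinarith)
  have hb : Real.exp (k * x) ≤ 1 := Real.exp_le_one_iff.2 (by nlinarith)
  have ha0 := Real.exp_pos ((k + 1) * x)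
  have hb0 := Real.exp_pos (k * x)
  have hab : Real.exp (k * x) ^ 2 ≤ Real.exp ((k + 1) * x) := by
    rw [← Real.exp_nat_mul]
    refine Real.exp_le_exp.2 ?_
    push_cast
    nlinarith
  have a1 := le_dilog ⟨ha0.le, ha⟩
  have a2 := dilog_le ⟨ha0.le, ha⟩
  have b1 := le_dilog ⟨hb0.le, hb⟩
  have b2 := dilog_le ⟨hb0.le, hb⟩
  rw [ratePotential_eq_dilog hk hx]
  set A := dilog (Real.exp ((k + 1) * x))
  set B := dilog (Real.exp (k * x))
  set a := Real.exp ((k + 1) * x)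
  set b := Real.exp (k * x)
  have hA : A / (k + 1) ≤ A := div_le_self (by linarith) (by linarith)
  have hA0 : 0 ≤ A / (k + 1) := by
    have : 0 ≤ A := by linarith
    positivity
  have hB : (B - b) / k ≤ B - b := div_le_self (by linarith) hkp
  have hB0 : 0 ≤ (B - b) / k := div_nonneg (by linarith) (by linarith)
  have e : B / k - A / (k + 1) - b / k = (B - b) / k - A / (k + 1) := by ring
  rw [e, abs_le]
  constructor <;> nlinarith

/-! ### The approximate solution and its residual -/

lemma expMoment_rate {k : ℕ} (hk : 1 ≤ k) {y : ℝ} (hy : 0 < y) :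
    expMoment k 0 (rate k y) = 1 / (Real.exp y - 1) := by
  have h := exp_rateInv hk (rate k y)
  rw [rateInv_rate hk hy] at h
  rw [h, add_sub_cancel_left, one_div_one_div]

lemma expMoment_rate_le {k : ℕ} (hk : 1 ≤ k) {y : ℝ} (hy : 0 < y) :
    expMoment k 0 (rate k y) ≤ 1 / y := by
  rw [expMoment_rate hk hy]
  exact one_div_le_one_div_of_le hy (by linarith [Real.add_one_le_exp y])

/-- `M₀ (1 + M₀) = 1 / (4 sinh² (y / 2)) ≤ 1 / y²`. -/
lemma expMoment_rate_mul_le {k : ℕ} (hk : 1 ≤ k) {y : ℝ} (hy : 0 < y) :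
    expMoment k 0 (rate k y) * (1 + expMoment k 0 (rate k y)) ≤ 1 / y ^ 2 := by
  have h1 : 0 < Real.exp y - 1 := by linarith [Real.add_one_le_exp y]
  have hsinh : y / 2 ≤ Real.sinh (y / 2) := Real.self_le_sinh_iff.2 (by linarith)
  have he : Real.exp y - 1 = Real.exp (y / 2) * (2 * Real.sinh (y / 2)) := by
    rw [Real.sinh_eq, mul_div_cancel₀ _ two_ne_zero, mul_sub, ← Real.exp_add, ← Real.exp_add]
    simp
  have hsq : Real.exp y = Real.exp (y / 2) ^ 2 := by
    rw [← Real.exp_nat_mul]; congr 1; push_cast; ring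
  have hmul : y ^ 2 * Real.exp y ≤ (Real.exp y - 1) ^ 2 := by
    rw [he, mul_pow, hsq, mul_comm]
    gcongr
    linarith
  rw [expMoment_rate hk hy]
  have : 1 / (Real.exp y - 1) * (1 + 1 / (Real.exp y - 1)) = Real.exp y / (Real.exp y - 1) ^ 2 := by
    field_simp
    ring
  rw [this, div_le_div_iff₀ (by positivity) (by positivity)]
  linarith

/-- The leading exponent `S`, normalised so that `S y - y ^ 2 / 2 → 0` at infinity;
`S' = rate k`. -/
noncomputable def action (k : ℕ) (y : ℝ) : ℝ :=
  Real.pi ^ 2 / (3 * (k * (k + 1))) + rate k y * y - ratePotential k (rate k y)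

/-- The logarithm of the amplitude multiplying `e^{-S/s}`. -/
noncomputable def logAmp (k : ℕ) (y : ℝ) : ℝ := -Real.log (expMoment k 1 (rate k y)) / 2

/-- The logarithm of the approximate solution `E(y) = e^{-S(y)/s} / √(M₁(ℓ(y)))`. -/
noncomputable def logApprox (k : ℕ) (s y : ℝ) : ℝ := -action k y / s + logAmp k y

lemma hasDerivAt_action {k : ℕ} (hk : 1 ≤ k) {y : ℝ} (hy : 0 < y) :
    HasDerivAt (action k) (rate k y) y := by
  have hr := hasDerivAt_rate hk hy
  have hp := (hasDerivAt_ratePotential hk (rate k y)).comp y hr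
  rw [rateInv_rate hk hy] at hp
  refine (((hr.mul (hasDerivAt_id y)).const_add _).sub hp).congr_deriv ?_
  simp only [id_eq]
  ring

lemma hasDerivAt_logAmp {k : ℕ} (hk : 1 ≤ k) {y : ℝ} (hy : 0 < y) :
    HasDerivAt (logAmp k) (ampSpeed k (rate k y) / 2) y := by
  have hr := hasDerivAt_rate hk hy
  have h1 := expMoment_pos hk 1 (rate k y)
  have hm := ((hasDerivAt_expMoment k 1 (rate k y)).comp y hr).log h1.ne'
  refine (hm.neg.div_const 2).congr_deriv ?_
  simp only [ampSpeed, Nat.reduceAdd, Function.comp]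
  field_simp

/-- First order Taylor estimate, with a crude constant. -/
lemma abs_taylor_one_le {f f' f'' : ℝ → ℝ} {a b K : ℝ} (hab : a ≤ b)
    (h1 : ∀ x ∈ Set.Icc a b, HasDerivAt f (f' x) x)
    (h2 : ∀ x ∈ Set.Icc a b, HasDerivAt f' (f'' x) x)
    (hK : ∀ x ∈ Set.Icc a b, |f'' x| ≤ K) :
    |f b - f a - (b - a) * f' a| ≤ K * (b - a) ^ 2 := by
  have ha : a ∈ Set.Icc a b := ⟨le_rfl, hab⟩
  have hb : b ∈ Set.Icc a b := ⟨hab, le_rfl⟩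
  have hK0 : 0 ≤ K := (abs_nonneg _).trans (hK a ha)
  have hf' : ∀ x ∈ Set.Icc a b, |f' x - f' a| ≤ K * (b - a) := by
    intro x hx
    have := (convex_Icc a b).norm_image_sub_le_of_norm_hasDerivWithin_le
      (fun z hz => (h2 z hz).hasDerivWithinAt) hK ha hx
    refine this.trans ?_
    rw [Real.norm_of_nonneg (by linarith [hx.1])]
    have := hx.2
    gcongr
  have := (convex_Icc a b).norm_image_sub_le_of_norm_hasDerivWithin_le
    (f := fun x => f x - x * f' a) (f' := fun x => f' x - f' a)
    (fun z hz => (((h1 z hz).sub ((hasDerivAt_id z).mul_const (f' a))).congr_deriv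
      (by ring)).hasDerivWithinAt) hf' ha hb
  rw [Real.norm_of_nonneg (show 0 ≤ b - a by linarith), Real.norm_eq_abs] at this
  calc _ = |f b - b * f' a - (f a - a * f' a)| := by ring_nf
    _ ≤ _ := this
    _ = _ := by ring

/-- Second order Taylor estimate, with a crude constant. -/
lemma abs_taylor_two_le {F f f' f'' : ℝ → ℝ} {a b K : ℝ} (hab : a ≤ b)
    (h0 : ∀ x ∈ Set.Icc a b, HasDerivAt F (f x) x)
    (h1 : ∀ x ∈ Set.Icc a b, HasDerivAt f (f' x) x)
    (h2 : ∀ x ∈ Set.Icc a b, HasDerivAt f' (f'' x) x)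
    (hK : ∀ x ∈ Set.Icc a b, |f'' x| ≤ K) :
    |F b - F a - (b - a) * f a - (b - a) ^ 2 / 2 * f' a| ≤ K * (b - a) ^ 3 := by
  have ha : a ∈ Set.Icc a b := ⟨le_rfl, hab⟩
  have hb : b ∈ Set.Icc a b := ⟨hab, le_rfl⟩
  have hK0 : 0 ≤ K := (abs_nonneg _).trans (hK a ha)
  have hf : ∀ x ∈ Set.Icc a b, |f x - f a - (x - a) * f' a| ≤ K * (b - a) ^ 2 := by
    intro x hx
    have hsub : Set.Icc a x ⊆ Set.Icc a b := Set.Icc_subset_Icc_right hx.2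
    refine (abs_taylor_one_le hx.1 (fun z hz => h1 z (hsub hz)) (fun z hz => h2 z (hsub hz))
      (fun z hz => hK z (hsub hz))).trans ?_
    have := hx.1
    have := hx.2
    gcongr
  have := (convex_Icc a b).norm_image_sub_le_of_norm_hasDerivWithin_le
    (f := fun x => F x - x * f a - (x - a) ^ 2 / 2 * f' a)
    (f' := fun x => f x - f a - (x - a) * f' a)
    (fun z hz => ((((h0 z hz).sub ((hasDerivAt_id z).mul_const (f a))).sub
      (((((hasDerivAt_id z).sub_const a).pow 2).div_const 2).mul_const (f' a))).congr_deriv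
      (by simp)).hasDerivWithinAt) hf ha hb
  rw [Real.norm_of_nonneg (show 0 ≤ b - a by linarith), Real.norm_eq_abs] at this
  calc _ = |F b - b * f a - (b - a) ^ 2 / 2 * f' a - (F a - a * f a - (a - a) ^ 2 / 2 * f' a)| := by
        ring_nf
    _ ≤ _ := this
    _ = _ := by ring

/-- The coefficient of `s` in `log E(y + js) - log E(y)`. -/
noncomputable def stepCoeff (k j : ℕ) (x : ℝ) : ℝ :=
  (j : ℝ) / 2 * rateSpeed k x * (expMoment k 2 x / expMoment k 1 x - j)

/-- The amplitude is chosen so that the first order corrections cancel on average. -/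
lemma sum_exp_mul_stepCoeff {k : ℕ} (hk : 1 ≤ k) (x : ℝ) :
    ∑ j ∈ Finset.Icc 1 k, Real.exp (-(j * x)) * stepCoeff k j x = 0 := by
  have h1 := expMoment_pos hk 1 x
  have : ∀ j ∈ Finset.Icc 1 k, Real.exp (-(j * x)) * stepCoeff k j x
      = rateSpeed k x / 2 * ((expMoment k 2 x / expMoment k 1 x)
          * ((j : ℝ) ^ 1 * Real.exp (-(j * x))) - (j : ℝ) ^ 2 * Real.exp (-(j * x))) := by
    intro j _
    unfold stepCoeff
    ring
  rw [Finset.sum_congr rfl this, ← Finset.mul_sum, Finset.sum_sub_distrib, ← Finset.mul_sum]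
  change rateSpeed k x / 2 * (expMoment k 2 x / expMoment k 1 x * expMoment k 1 x
    - expMoment k 2 x) = 0
  field_simp
  ring

lemma sum_exp_mul_stepCoeff_sq {k : ℕ} (hk : 1 ≤ k) :
    ∃ C : ℝ, 0 < C ∧ ∀ x, ∑ j ∈ Finset.Icc 1 k, Real.exp (-(j * x)) * stepCoeff k j x ^ 2
      ≤ C * (expMoment k 0 x * (expMoment k 0 x * (1 + expMoment k 0 x))) := by
  have hkp : (0 : ℝ) < k := by exact_mod_cast hk
  refine ⟨k * (k * (k * ((k : ℝ) ^ 3 + 1))), by positivity, fun x => ?_⟩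
  have h1 := expMoment_pos hk 1 x
  have hM := expMoment_pos hk 0 x
  obtain ⟨f0, f1⟩ := expMoment_three_frac_bound hk x
  set μ := expMoment k 2 x / expMoment k 1 x with hμ
  set g := rateSpeed k x
  have hg : g ≤ 1 + expMoment k 0 x := rateSpeed_le hk x
  have hg0 : 0 < g := rateSpeed_pos hk x
  have hterm : ∀ j ∈ Finset.Icc 1 k, Real.exp (-(j * x)) * stepCoeff k j x ^ 2
      ≤ k * g ^ 2 / 4 * (μ ^ 2 * ((j : ℝ) ^ 1 * Real.exp (-(j * x)))
        - 2 * μ * ((j : ℝ) ^ 2 * Real.exp (-(j * x))) + (j : ℝ) ^ 3 * Real.exp (-(j * x))) := by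
    intro j hj
    have hjk : (j : ℝ) ≤ k := by exact_mod_cast (Finset.mem_Icc.1 hj).2
    have e1 : Real.exp (-(j * x)) * stepCoeff k j x ^ 2
        = j * (g ^ 2 / 4 * (j * (μ - j) ^ 2) * Real.exp (-(j * x))) := by
      unfold stepCoeff
      ring
    rw [e1]
    refine (mul_le_mul_of_nonneg_right hjk (by positivity)).trans (le_of_eq ?_)
    ring
  refine (Finset.sum_le_sum hterm).trans ?_
  rw [← Finset.mul_sum, Finset.sum_add_distrib, Finset.sum_sub_distrib, ← Finset.mul_sum,
    ← Finset.mul_sum]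
  change k * g ^ 2 / 4 * (μ ^ 2 * expMoment k 1 x - 2 * μ * expMoment k 2 x + expMoment k 3 x) ≤ _
  have e2 : μ ^ 2 * expMoment k 1 x - 2 * μ * expMoment k 2 x + expMoment k 3 x
      = expMoment k 1 x * ((expMoment k 1 x * expMoment k 3 x - expMoment k 2 x ^ 2)
        / expMoment k 1 x ^ 2) := by
    rw [hμ]
    field_simp
    ring
  have hm1 : expMoment k 1 x ≤ k * expMoment k 0 x := expMoment_succ_le k 0 x
  have hmin := one_add_mul_min_le hM.le
  rw [e2]
  set M := expMoment k 0 x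
  have hc : 0 ≤ k * ((k : ℝ) ^ 3 + 1) := by positivity
  calc _ ≤ k * (1 + M) ^ 2 / 4 * ((k * M) * (k * ((k : ℝ) ^ 3 + 1) * min 1 M)) := by gcongr
    _ = k * (k * (k * ((k : ℝ) ^ 3 + 1))) * (M * (1 + M)) * ((1 + M) * min 1 M) / 4 := by ring
    _ ≤ k * (k * (k * ((k : ℝ) ^ 3 + 1))) * (M * (1 + M)) * (2 * M) / 4 := by gcongr
    _ ≤ _ := by
      have : 0 ≤ k * (k * (k * ((k : ℝ) ^ 3 + 1))) * (M * (M * (1 + M))) := by positivity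
      linarith

/-- The increments of `log E` up to `O(s² / y²)`, uniformly on all of `y > 0`. -/
lemma logApprox_step {k : ℕ} (hk : 1 ≤ k) :
    ∃ C : ℝ, 0 < C ∧ ∀ s y : ℝ, 0 < s → 0 < y → ∀ j ∈ Finset.Icc 1 k,
      |logApprox k s (y + j * s) - logApprox k s y
        - (-(j * rate k y) + s * stepCoeff k j (rate k y))| ≤ C * (s ^ 2 / y ^ 2) := by
  obtain ⟨C1, hC1, hb1⟩ := rateSpeedDeriv_bound hk
  obtain ⟨C2, hC2, hb2⟩ := ampSpeedDeriv_bound hk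
  have hkp : (0 : ℝ) < k := by exact_mod_cast hk
  refine ⟨C1 * (k : ℝ) ^ 3 + C2 * (k : ℝ) ^ 2, by positivity, fun s y hs hy j hj => ?_⟩
  have hjk : (j : ℝ) ≤ k := by exact_mod_cast (Finset.mem_Icc.1 hj).2
  have hj0 : (0 : ℝ) ≤ j := Nat.cast_nonneg j
  have hyb : y ≤ y + j * s := by nlinarith
  have hpos : ∀ z ∈ Set.Icc y (y + j * s), 0 < z := fun z hz => hy.trans_le hz.1
  have hgen : ∀ (D : ℝ → ℝ) (C : ℝ), 0 < C → (∀ x, |D x| ≤ C * expMoment k 0 x) →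
      ∀ z ∈ Set.Icc y (y + j * s), |D (rate k z) * rateSpeed k (rate k z)| ≤ C * (1 / y ^ 2) := by
    intro D C hC hD z hz
    have hz0 := hpos z hz
    have hM := expMoment_pos hk 0 (rate k z)
    rw [abs_mul, abs_of_pos (rateSpeed_pos hk (rate k z))]
    calc _ ≤ C * expMoment k 0 (rate k z) * (1 + expMoment k 0 (rate k z)) :=
          mul_le_mul (hD _) (rateSpeed_le hk _) (rateSpeed_pos hk _).le (by positivity)
      _ = C * (expMoment k 0 (rate k z) * (1 + expMoment k 0 (rate k z))) := by ring
      _ ≤ C * (1 / z ^ 2) := by gcongr; exact expMoment_rate_mul_le hk hz0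
      _ ≤ C * (1 / y ^ 2) := by
        have := hz.1
        gcongr
  have hS := abs_taylor_two_le (F := action k) (f := rate k)
    (f' := fun z => rateSpeed k (rate k z))
    (f'' := fun z => rateSpeedDeriv k (rate k z) * rateSpeed k (rate k z)) hyb
    (fun z hz => hasDerivAt_action hk (hpos z hz)) (fun z hz => hasDerivAt_rate hk (hpos z hz))
    (fun z hz => (hasDerivAt_rateSpeed hk (rate k z)).comp z (hasDerivAt_rate hk (hpos z hz)))
    (hgen _ C1 hC1 hb1)
  have hL := abs_taylor_one_le (f := fun z => 2 * logAmp k z)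
    (f' := fun z => ampSpeed k (rate k z))
    (f'' := fun z => ampSpeedDeriv k (rate k z) * rateSpeed k (rate k z)) hyb
    (fun z hz => ((hasDerivAt_logAmp hk (hpos z hz)).const_mul 2).congr_deriv (by ring))
    (fun z hz => (hasDerivAt_ampSpeed hk (rate k z)).comp z (hasDerivAt_rate hk (hpos z hz)))
    (hgen _ C2 hC2 hb2)
  simp only [add_sub_cancel_left] at hS hL
  set A := action k (y + j * s) - action k y - j * s * rate k y
    - (j * s) ^ 2 / 2 * rateSpeed k (rate k y) with hA
  set B := 2 * logAmp k (y + j * s) - 2 * logAmp k y - j * s * ampSpeed k (rate k y) with hB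
  have e : logApprox k s (y + j * s) - logApprox k s y
        - (-(j * rate k y) + s * stepCoeff k j (rate k y)) = -(A / s) + B / 2 := by
    rw [hA, hB]
    simp only [logApprox, stepCoeff, ampSpeed]
    field_simp
    ring
  rw [e]
  have hA' : |A / s| ≤ C1 * (k : ℝ) ^ 3 * (s ^ 2 / y ^ 2) := by
    rw [abs_div, abs_of_pos hs, div_le_iff₀ hs]
    refine hS.trans ?_
    have : (j : ℝ) ^ 3 ≤ (k : ℝ) ^ 3 := by gcongr
    calc C1 * (1 / y ^ 2) * (j * s) ^ 3 = C1 * (1 / y ^ 2) * s ^ 3 * (j : ℝ) ^ 3 := by ring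
      _ ≤ C1 * (1 / y ^ 2) * s ^ 3 * (k : ℝ) ^ 3 := by gcongr
      _ = _ := by ring
  have hB' : |B / 2| ≤ C2 * (k : ℝ) ^ 2 * (s ^ 2 / y ^ 2) := by
    rw [abs_div, abs_two]
    have : (j : ℝ) ^ 2 ≤ (k : ℝ) ^ 2 := by gcongr
    have h3 : |B| ≤ C2 * (k : ℝ) ^ 2 * (s ^ 2 / y ^ 2) := by
      refine hL.trans ?_
      calc C2 * (1 / y ^ 2) * (j * s) ^ 2 = C2 * (1 / y ^ 2) * s ^ 2 * (j : ℝ) ^ 2 := by ring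
        _ ≤ C2 * (1 / y ^ 2) * s ^ 2 * (k : ℝ) ^ 2 := by gcongr
        _ = _ := by ring
    linarith [abs_nonneg B]
  calc _ ≤ |-(A / s)| + |B / 2| := abs_add_le _ _
    _ ≤ _ := by rw [abs_neg]; linarith

/-- On the lattice `y = ns` the corrections in the increments are bounded. -/
lemma abs_stepCoeff_le {k : ℕ} (hk : 1 ≤ k) {s : ℝ} (hs : 0 < s) (hs1 : s ≤ 1) {n : ℕ}
    (hn : 1 ≤ n) {j : ℕ} (hj : j ∈ Finset.Icc 1 k) :
    |s * stepCoeff k j (rate k (n * s))| ≤ (k : ℝ) ^ 2 := by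
  have hjk : (j : ℝ) ≤ k := by exact_mod_cast (Finset.mem_Icc.1 hj).2
  have hj0 : (0 : ℝ) ≤ j := Nat.cast_nonneg j
  have hn' : (1 : ℝ) ≤ n := by exact_mod_cast hn
  have hy : 0 < n * s := by positivity
  obtain ⟨r0, r1⟩ := expMoment_ratio_bound hk 1 (rate k (n * s))
  simp only [Nat.reduceAdd] at r0 r1
  have hg := rateSpeed_le hk (rate k (n * s))
  have hg0 := rateSpeed_pos hk (rate k (n * s))
  have hsg : s * rateSpeed k (rate k (n * s)) ≤ 2 := by
    have hM := expMoment_rate_le hk hy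
    calc _ ≤ s * (1 + 1 / (n * s)) := by gcongr; linarith
      _ = s + 1 / n := by field_simp
      _ ≤ 1 + 1 := by
        gcongr
        rw [div_le_one (by linarith)]
        exact hn'
      _ = 2 := by norm_num
  have hd : |expMoment k 2 (rate k (n * s)) / expMoment k 1 (rate k (n * s)) - j| ≤ k := by
    rw [abs_le]; constructor <;> linarith
  have e : s * stepCoeff k j (rate k (n * s)) = j / 2 * (s * rateSpeed k (rate k (n * s))) *
      (expMoment k 2 (rate k (n * s)) / expMoment k 1 (rate k (n * s)) - j) := by
    unfold stepCoeff; ring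
  rw [e, abs_mul, abs_of_nonneg (by positivity)]
  calc _ ≤ (k : ℝ) / 2 * 2 * k := by gcongr
    _ = _ := by ring

lemma exp_le_one_add_add_sq {z K : ℝ} (hz : |z| ≤ K) :
    Real.exp z ≤ 1 + z + z ^ 2 * Real.exp K := by
  have h := Complex.norm_exp_sub_sum_le_norm_mul_exp (z : ℂ) 2
  simp only [Finset.sum_range_succ, Finset.sum_range_zero, pow_zero, Nat.factorial, pow_one,
    zero_add, Nat.cast_one, div_one, mul_one] at h
  rw [show Complex.exp z - (1 + (z : ℂ)) = ((Real.exp z - (1 + z) : ℝ) : ℂ) by push_cast; ring,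
    Complex.norm_real, Complex.norm_real, Real.norm_eq_abs, Real.norm_eq_abs, sq_abs] at h
  have h2 : z ^ 2 * Real.exp |z| ≤ z ^ 2 * Real.exp K := by gcongr
  linarith [le_abs_self (Real.exp z - (1 + z))]

/-- `E` solves the recurrence up to a relative error `O(1 / n²)` at the `n`-th site, uniformly in
`s`. -/
lemma logApprox_residual {k : ℕ} (hk : 1 ≤ k) :
    ∃ C : ℝ, 0 < C ∧ ∀ s : ℝ, 0 < s → s ≤ 1 → ∀ n : ℕ, 1 ≤ n →
      Real.exp (logApprox k s (n * s) - C / (n : ℝ) ^ 2) ≤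
        (Real.exp (n * s) - 1) * ∑ j ∈ Finset.Icc 1 k, Real.exp (logApprox k s ((n + j : ℕ) * s)) ∧
      (Real.exp (n * s) - 1) * ∑ j ∈ Finset.Icc 1 k, Real.exp (logApprox k s ((n + j : ℕ) * s)) ≤
        Real.exp (logApprox k s (n * s) + C / (n : ℝ) ^ 2) := by
  obtain ⟨C1, hC1, hb1⟩ := logApprox_step hk
  obtain ⟨C2, hC2, hb2⟩ := sum_exp_mul_stepCoeff_sq hk
  refine ⟨C1 + C2 * Real.exp ((k : ℝ) ^ 2), by positivity, fun s hs hs1 n hn => ?_⟩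
  have hn' : (1 : ℝ) ≤ n := by exact_mod_cast hn
  have hy : 0 < n * s := by positivity
  set x := rate k (n * s)
  set M := expMoment k 0 x with hM
  have hMp : 0 < M := expMoment_pos hk 0 x
  have hMe : Real.exp (n * s) - 1 = 1 / M := by
    rw [hM, expMoment_rate hk hy, one_div_one_div]
  have hMb : M * (1 + M) ≤ 1 / (n * s) ^ 2 := expMoment_rate_mul_le hk hy
  set W := logApprox k s (n * s)
  have hsy : s ^ 2 / (n * s) ^ 2 = 1 / (n : ℝ) ^ 2 := by field_simp
  have hstep : ∀ j ∈ Finset.Icc 1 k, |logApprox k s ((n + j : ℕ) * s) - W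
        - (-(j * x) + s * stepCoeff k j x)| ≤ C1 / (n : ℝ) ^ 2 := by
    intro j hj
    have := hb1 s (n * s) hs hy j hj
    rw [hsy, mul_one_div] at this
    convert this using 5
    push_cast
    ring
  have hM' : ∑ j ∈ Finset.Icc 1 k, Real.exp (-((j : ℕ) * x)) = M := by
    simp [hM, expMoment]
  rw [hMe]
  constructor
  · have hlow : ∀ j ∈ Finset.Icc 1 k,
        Real.exp (W - C1 / (n : ℝ) ^ 2) *
          (Real.exp (-(j * x)) + s * (Real.exp (-(j * x)) * stepCoeff k j x))
        ≤ Real.exp (logApprox k s ((n + j : ℕ) * s)) := by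
      intro j hj
      have h := (abs_le.1 (hstep j hj)).1
      calc _ = Real.exp (W - C1 / (n : ℝ) ^ 2) * Real.exp (-(j * x))
            * (s * stepCoeff k j x + 1) := by ring
        _ ≤ Real.exp (W - C1 / (n : ℝ) ^ 2) * Real.exp (-(j * x))
            * Real.exp (s * stepCoeff k j x) := by gcongr; exact Real.add_one_le_exp _
        _ ≤ _ := by
          rw [← Real.exp_add, ← Real.exp_add]
          exact Real.exp_le_exp.2 (by linarith)
    have hsum := Finset.sum_le_sum hlow
    rw [← Finset.mul_sum, Finset.sum_add_distrib, ← Finset.mul_sum, sum_exp_mul_stepCoeff hk,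
      hM', mul_zero, add_zero] at hsum
    calc _ ≤ Real.exp (W - C1 / (n : ℝ) ^ 2) := by
          refine Real.exp_le_exp.2 ?_
          gcongr
          have : 0 < C2 * Real.exp ((k : ℝ) ^ 2) := by positivity
          linarith
      _ = 1 / M * (Real.exp (W - C1 / (n : ℝ) ^ 2) * M) := by field_simp
      _ ≤ _ := by gcongr
  · have hup : ∀ j ∈ Finset.Icc 1 k, Real.exp (logApprox k s ((n + j : ℕ) * s)) ≤
        Real.exp (W + C1 / (n : ℝ) ^ 2) *
          (Real.exp (-(j * x)) + s * (Real.exp (-(j * x)) * stepCoeff k j x)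
            + s ^ 2 * Real.exp ((k : ℝ) ^ 2) * (Real.exp (-(j * x)) * stepCoeff k j x ^ 2)) := by
      intro j hj
      have h := (abs_le.1 (hstep j hj)).2
      have hz := exp_le_one_add_add_sq (abs_stepCoeff_le hk hs hs1 hn hj)
      calc _ ≤ Real.exp (W + C1 / (n : ℝ) ^ 2) * Real.exp (-(j * x))
            * Real.exp (s * stepCoeff k j x) := by
            rw [← Real.exp_add, ← Real.exp_add]
            exact Real.exp_le_exp.2 (by linarith)
        _ ≤ Real.exp (W + C1 / (n : ℝ) ^ 2) * Real.exp (-(j * x))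
            * (1 + s * stepCoeff k j x + (s * stepCoeff k j x) ^ 2 * Real.exp ((k : ℝ) ^ 2)) := by
            gcongr
        _ = _ := by ring
    have hsum := Finset.sum_le_sum hup
    rw [← Finset.mul_sum, Finset.sum_add_distrib, Finset.sum_add_distrib, ← Finset.mul_sum,
      ← Finset.mul_sum, sum_exp_mul_stepCoeff hk, hM', mul_zero, add_zero] at hsum
    have hquad : s ^ 2 * Real.exp ((k : ℝ) ^ 2) *
        ∑ j ∈ Finset.Icc 1 k, Real.exp (-((j : ℕ) * x)) * stepCoeff k j x ^ 2
        ≤ M * (C2 * Real.exp ((k : ℝ) ^ 2) / (n : ℝ) ^ 2) := by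
      calc _ ≤ s ^ 2 * Real.exp ((k : ℝ) ^ 2) * (C2 * (M * (M * (1 + M)))) := by
            gcongr; exact hb2 x
        _ ≤ s ^ 2 * Real.exp ((k : ℝ) ^ 2) * (C2 * (M * (1 / (n * s) ^ 2))) := by gcongr
        _ = _ := by field_simp
    calc _ ≤ 1 / M * (Real.exp (W + C1 / (n : ℝ) ^ 2)
          * (M + M * (C2 * Real.exp ((k : ℝ) ^ 2) / (n : ℝ) ^ 2))) := by
          refine mul_le_mul_of_nonneg_left (hsum.trans ?_) (by positivity)
          gcongr
      _ = Real.exp (W + C1 / (n : ℝ) ^ 2) * (C2 * Real.exp ((k : ℝ) ^ 2) / (n : ℝ) ^ 2 + 1) := by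
          field_simp
          ring
      _ ≤ Real.exp (W + C1 / (n : ℝ) ^ 2) * Real.exp (C2 * Real.exp ((k : ℝ) ^ 2) / (n : ℝ) ^ 2) := by
          gcongr
          exact Real.add_one_le_exp _
      _ = _ := by
          rw [← Real.exp_add]
          congr 1
          ring

/-! ### Comparison with exact solutions -/

/-- A sub- and a supersolution `f` and `g` of the same positive recurrence, up to relative errors
`O(1 / n²)`, keep at every site the order they have at infinity, up to a factor `e^{O(1/n)}`. -/
lemma le_of_recurrence {k : ℕ} {f g w : ℕ → ℝ} {C : ℝ} (hC : 0 ≤ C) (hw : ∀ n, 0 ≤ w n)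
    (hg : ∀ n, 1 ≤ n → 0 < g n)
    (hf : ∀ n, 1 ≤ n →
      f n ≤ Real.exp (C / (n : ℝ) ^ 2) * (w n * ∑ j ∈ Finset.Icc 1 k, f (n + j)))
    (hgr : ∀ n, 1 ≤ n →
      w n * ∑ j ∈ Finset.Icc 1 k, g (n + j) ≤ Real.exp (C / (n : ℝ) ^ 2) * g n)
    (hlim : ∀ a : ℝ, 1 < a → ∀ᶠ n in atTop, f n ≤ a * g n) (n : ℕ) (hn : 1 ≤ n) :
    f n ≤ Real.exp (4 * C / n) * g n := by
  have hgn := hg n hn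
  refine (le_iff_forall_one_lt_le_mul₀ (by positivity)).2 fun a ha => ?_
  obtain ⟨K, hK⟩ := eventually_atTop.1 (hlim a ha)
  have key : ∀ i m : ℕ, 1 ≤ m → K ≤ m + i → f m ≤ Real.exp (4 * C / m) * g m * a := by
    intro i
    induction i with
    | zero =>
      intro m hm hKm
      have := hg m hm
      have h1 : 1 ≤ Real.exp (4 * C / m) := Real.one_le_exp (by positivity)
      calc f m ≤ 1 * (a * g m) := by rw [one_mul]; exact hK m (by omega)
        _ ≤ Real.exp (4 * C / m) * (a * g m) := by gcongr
        _ = _ := by ring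
    | succ i ih =>
      intro m hm hKm
      have hm' : (1 : ℝ) ≤ m := by exact_mod_cast hm
      have hgm := hg m hm
      have hterm : ∀ j ∈ Finset.Icc 1 k, f (m + j) ≤ Real.exp (4 * C / (m + 1)) * a * g (m + j) := by
        intro j hj
        have hj1 : 1 ≤ j := (Finset.mem_Icc.1 hj).1
        have := hg (m + j) (by omega)
        have hj1' : (1 : ℝ) ≤ j := by exact_mod_cast hj1
        refine (ih (m + j) (by omega) (by omega)).trans ?_
        rw [mul_right_comm]
        push_cast
        gcongr
      have hwm := hw m
      calc f m ≤ Real.exp (C / (m : ℝ) ^ 2) * (w m * ∑ j ∈ Finset.Icc 1 k, f (m + j)) := hf m hm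
        _ ≤ Real.exp (C / (m : ℝ) ^ 2) * (w m * ∑ j ∈ Finset.Icc 1 k,
              Real.exp (4 * C / (m + 1)) * a * g (m + j)) := by
            gcongr with j hj
            exact hterm j hj
        _ = Real.exp (C / (m : ℝ) ^ 2) * Real.exp (4 * C / (m + 1)) * a *
              (w m * ∑ j ∈ Finset.Icc 1 k, g (m + j)) := by
            rw [← Finset.mul_sum]; ring
        _ ≤ Real.exp (C / (m : ℝ) ^ 2) * Real.exp (4 * C / (m + 1)) * a *
              (Real.exp (C / (m : ℝ) ^ 2) * g m) := by
            exact mul_le_mul_of_nonneg_left (hgr m hm) (by positivity)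
        _ = Real.exp (C / (m : ℝ) ^ 2 + 4 * C / (m + 1) + C / (m : ℝ) ^ 2) * g m * a := by
            rw [Real.exp_add, Real.exp_add]; ring
        _ ≤ _ := by
            gcongr
            -- telescoping: `2 / m² ≤ 4 / (m (m + 1))`
            have e : 4 * C / m - (C / (m : ℝ) ^ 2 + 4 * C / (m + 1) + C / (m : ℝ) ^ 2)
                = C * (2 * m - 2) / (m ^ 2 * (m + 1)) := by
              field_simp
              ring
            have : 0 ≤ C * (2 * m - 2) / ((m : ℝ) ^ 2 * (m + 1)) :=
              div_nonneg (mul_nonneg hC (by linarith)) (by positivity)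
            linarith
  exact key K n hn (by omega)

/-- `d` is a nonnegative solution of `d_n = ∑_{j=1}^k (e^{(n+j)s} - 1) d_{n+j}` with
`d_n ~ e^{-s n (n+1) / 2}` at infinity. -/
structure IsRecSol (k : ℕ) (s : ℝ) (d : ℕ → ℝ) : Prop where
  nonneg : ∀ n, 0 ≤ d n
  eq_sum : ∀ n, d n = ∑ j ∈ Finset.Icc 1 k, (Real.exp ((n + j : ℕ) * s) - 1) * d (n + j)
  tendsto : Tendsto (fun n : ℕ => d n * Real.exp (s * (n * (n + 1) / 2))) atTop (𝓝 1)

lemma tendsto_expMoment_mul_exp {k : ℕ} (hk : 1 ≤ k) (r : ℕ) :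
    Tendsto (fun x => expMoment k r x * Real.exp x) atTop (𝓝 1) := by
  have h : ∀ j ∈ Finset.Icc 1 k, Tendsto (fun x : ℝ => (j : ℝ) ^ r * Real.exp (-(j * x)) * Real.exp x)
      atTop (𝓝 (if j = 1 then 1 else 0)) := by
    intro j hj
    have hj1 := (Finset.mem_Icc.1 hj).1
    split_ifs with h1
    · subst h1
      refine tendsto_const_nhds.congr fun x => ?_
      rw [Nat.cast_one, one_pow, one_mul, one_mul, ← Real.exp_add, neg_add_cancel, Real.exp_zero]
    · have hj2 : (2 : ℝ) ≤ j := by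
        have : 2 ≤ j := by omega
        exact_mod_cast this
      have h2 : Tendsto (fun x : ℝ => (j : ℝ) ^ r * Real.exp (-((j - 1) * x))) atTop
          (𝓝 ((j : ℝ) ^ r * 0)) := by
        refine Tendsto.const_mul _ (Real.tendsto_exp_neg_atTop_nhds_zero.comp ?_)
        exact tendsto_id.const_mul_atTop (by linarith)
      rw [mul_zero] at h2
      refine h2.congr fun x => ?_
      rw [mul_assoc, ← Real.exp_add]
      congr 2
      ring
  have hs := tendsto_finsetSum _ h
  simp only [Finset.sum_ite_eq', Finset.mem_Icc, le_refl, hk, and_self, if_true] at hs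
  refine hs.congr fun x => ?_
  rw [expMoment, Finset.sum_mul]

lemma tendsto_rateInv_neg {k : ℕ} (hk : 1 ≤ k) :
    Tendsto (fun x => rateInv k (-x)) atTop (𝓝 0) :=
  squeeze_zero (fun _ => (rateInv_pos hk _).le) (fun _ => rateInv_le_exp hk _)
    Real.tendsto_exp_neg_atTop_nhds_zero

lemma tendsto_ratePotential_neg {k : ℕ} (hk : 1 ≤ k) :
    Tendsto (fun x => ratePotential k (-x)) atTop (𝓝 0) := by
  have hkp : (1 : ℝ) ≤ k := by exact_mod_cast hk
  have hb : Tendsto (fun x : ℝ => 4 * Real.exp (-x)) atTop (𝓝 0) := by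
    simpa using Real.tendsto_exp_neg_atTop_nhds_zero.const_mul 4
  refine squeeze_zero_norm' ?_ hb
  filter_upwards [eventually_ge_atTop 0] with x hx
  have h := abs_ratePotential_sub_le hk (x := -x) (by linarith)
  have h1 : Real.exp (k * -x) ≤ Real.exp (-x) := Real.exp_le_exp.2 (by nlinarith)
  have h2 : Real.exp ((k + 1) * -x) ≤ Real.exp (-x) := Real.exp_le_exp.2 (by nlinarith)
  have h3 : Real.exp (k * -x) / k ≤ Real.exp (k * -x) := div_le_self (Real.exp_pos _).le hkp
  have h4 : 0 < Real.exp (k * -x) / k := by positivity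
  rw [Real.norm_eq_abs, abs_le]
  rw [abs_le] at h
  constructor <;> linarith [h.1, h.2]

lemma log_exp_sub_one_rateInv {k : ℕ} (hk : 1 ≤ k) (x : ℝ) :
    Real.log (Real.exp (rateInv k x) - 1) = -Real.log (expMoment k 0 x) := by
  rw [exp_rateInv hk, add_sub_cancel_left, one_div, Real.log_inv]

/-- The boundary behaviour of the approximate solution at infinity. -/
lemma tendsto_logApprox {k : ℕ} (hk : 1 ≤ k) (s : ℝ) :
    Tendsto (fun y => Real.log (Real.exp y - 1) - logApprox k s y - y ^ 2 / (2 * s) - y / 2)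
      atTop (𝓝 0) := by
  have hlog : ∀ r, Tendsto (fun x => Real.log (expMoment k r x * Real.exp x)) atTop (𝓝 0) := by
    intro r
    have := (tendsto_expMoment_mul_exp hk r).log one_ne_zero
    rwa [Real.log_one] at this
  have hx : Tendsto (fun x => (ratePotential k (-x) - rateInv k (-x) ^ 2 / 2) / s
      + Real.log (expMoment k 1 x * Real.exp x) / 2 - Real.log (expMoment k 0 x * Real.exp x)
      - rateInv k (-x) / 2) atTop (𝓝 0) := by
    have := (((((tendsto_ratePotential_neg hk).sub
      (((tendsto_rateInv_neg hk).pow 2).div_const 2)).div_const s).add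
      ((hlog 1).div_const 2)).sub (hlog 0)).sub ((tendsto_rateInv_neg hk).div_const 2)
    simpa using this
  refine (hx.comp (tendsto_rate_atTop hk)).congr' ?_
  filter_upwards [eventually_gt_atTop 0] with y hy
  set x := rate k y with hxdef
  have hyx : rateInv k x = y := rateInv_rate hk hy
  have h0 := expMoment_pos hk 0 x
  have h1 := expMoment_pos hk 1 x
  have hlogy : Real.log (Real.exp y - 1) = -Real.log (expMoment k 0 x) := by
    rw [← hyx, log_exp_sub_one_rateInv hk]
  have hsym := ratePotential_add_neg hk x
  have hneg := rateInv_neg hk x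
  rw [hyx] at hneg
  simp only [Function.comp, ← hxdef, logApprox, logAmp, action, hlogy, hneg]
  rw [Real.log_mul h0.ne' (Real.exp_pos _).ne', Real.log_mul h1.ne' (Real.exp_pos _).ne',
    Real.log_exp, show ratePotential k (-x)
      = Real.pi ^ 2 / (3 * (k * (k + 1))) + x ^ 2 / 2 - ratePotential k x by linarith]
  ring

lemma exp_sub_one_pos {n : ℕ} (hn : 1 ≤ n) {s : ℝ} (hs : 0 < s) : 0 < Real.exp (n * s) - 1 := by
  have : (1 : ℝ) ≤ n := by exact_mod_cast hn
  have h : 0 < n * s := by positivity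
  linarith [Real.add_one_le_exp (n * s)]

lemma IsRecSol.tendsto_ratio {k : ℕ} (hk : 1 ≤ k) {s : ℝ} (hs : 0 < s) {d : ℕ → ℝ}
    (hd : IsRecSol k s d) :
    Tendsto (fun n : ℕ => (Real.exp (n * s) - 1) * d n / Real.exp (logApprox k s (n * s)))
      atTop (𝓝 1) := by
  have hns : Tendsto (fun n : ℕ => (n : ℝ) * s) atTop atTop :=
    tendsto_natCast_atTop_atTop.atTop_mul_const hs
  have h1 := ((tendsto_logApprox hk s).comp hns).rexp
  have h2 := hd.tendsto.mul h1
  rw [Real.exp_zero, mul_one] at h2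
  refine h2.congr' ?_
  filter_upwards [eventually_ge_atTop 1] with n hn
  have hpos := exp_sub_one_pos hn hs
  simp only [Function.comp]
  rw [eq_div_iff (Real.exp_pos _).ne']
  calc _ = d n * (Real.exp (s * (n * (n + 1) / 2)) * Real.exp (Real.log (Real.exp (n * s) - 1)
        - logApprox k s (n * s) - (n * s) ^ 2 / (2 * s) - n * s / 2)
        * Real.exp (logApprox k s (n * s))) := by ring
    _ = d n * Real.exp (Real.log (Real.exp (n * s) - 1)) := by
        rw [← Real.exp_add, ← Real.exp_add]
        congr 2
        field_simp
        ring
    _ = _ := by rw [Real.exp_log hpos]; ring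

/-- Solutions of the recurrence are given by the approximate solution with relative error
`e^{O(1/n)}`, uniformly in `s`. -/
lemma IsRecSol.compare {k : ℕ} (hk : 1 ≤ k) :
    ∃ C : ℝ, 0 < C ∧ ∀ s : ℝ, 0 < s → s ≤ 1 → ∀ d : ℕ → ℝ, IsRecSol k s d → ∀ n : ℕ, 1 ≤ n →
      Real.exp (logApprox k s (n * s) - C / n) ≤ (Real.exp (n * s) - 1) * d n ∧
      (Real.exp (n * s) - 1) * d n ≤ Real.exp (logApprox k s (n * s) + C / n) := by
  obtain ⟨C, hC, hres⟩ := logApprox_residual hk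
  refine ⟨4 * C, by positivity, fun s hs hs1 d hd n hn => ?_⟩
  set e : ℕ → ℝ := fun n => (Real.exp (n * s) - 1) * d n with he
  set E : ℕ → ℝ := fun n => Real.exp (logApprox k s (n * s)) with hE
  set w : ℕ → ℝ := fun n => Real.exp (n * s) - 1 with hw
  have hw0 : ∀ n, 0 ≤ w n := fun n => by
    have : 1 ≤ Real.exp (n * s) := Real.one_le_exp (by positivity)
    simp only [hw]; linarith
  have hrec : ∀ n, e n = w n * ∑ j ∈ Finset.Icc 1 k, e (n + j) := fun n => by
    simp only [he, hw]
    rw [← hd.eq_sum n]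
  have hexp : ∀ n : ℕ, 1 ≤ Real.exp (C / (n : ℝ) ^ 2) := fun n => Real.one_le_exp (by positivity)
  have hEpos : ∀ n, 0 < E n := fun n => Real.exp_pos _
  have hlim : Tendsto (fun n => e n / E n) atTop (𝓝 1) := hd.tendsto_ratio hk hs
  have hepos : ∀ n, 1 ≤ n → 0 ≤ e n := fun n _ => mul_nonneg (hw0 n) (hd.nonneg n)
  have hup : ∀ n, 1 ≤ n → e n ≤ Real.exp (4 * C / n) * E n := by
    refine le_of_recurrence (k := k) hC.le hw0 (fun n _ => hEpos n) ?_ ?_ ?_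
    · intro n hn
      rw [← hrec]
      exact le_mul_of_one_le_left (hepos n hn) (hexp n)
    · intro n hn
      have := (hres s hs hs1 n hn).2
      rwa [add_comm, Real.exp_add] at this
    · intro a ha
      filter_upwards [hlim.eventually_lt_const ha] with n hn
      exact ((div_lt_iff₀ (hEpos n)).1 hn).le
  -- solutions are positive everywhere, since they are so near infinity
  have hepos' : ∀ n, 1 ≤ n → 0 < e n := by
    obtain ⟨K, hK⟩ := eventually_atTop.1 (hlim.eventually_const_lt (show (0 : ℝ) < 1 by norm_num))
    have key : ∀ i m : ℕ, 1 ≤ m → K ≤ m + i → 0 < e m := by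
      intro i
      induction i with
      | zero =>
        intro m _ hm
        have := mul_pos (hK m (by omega)) (hEpos m)
        rwa [div_mul_cancel₀ _ (hEpos m).ne'] at this
      | succ i ih =>
        intro m hm1 hm
        rw [hrec]
        refine mul_pos (exp_sub_one_pos hm1 hs) (Finset.sum_pos (fun j hj => ?_) ⟨1, by simp [hk]⟩)
        have := (Finset.mem_Icc.1 hj).1
        exact ih (m + j) (by omega) (by omega)
    exact fun n hn => key K n hn (by omega)
  have hlow : ∀ n, 1 ≤ n → E n ≤ Real.exp (4 * C / n) * e n := by
    refine le_of_recurrence (k := k) hC.le hw0 hepos' ?_ ?_ ?_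
    · intro n hn
      have := (hres s hs hs1 n hn).1
      rw [Real.exp_sub, div_le_iff₀ (Real.exp_pos _), mul_comm _ (Real.exp (C / (n : ℝ) ^ 2))] at this
      exact this
    · intro n hn
      rw [← hrec]
      exact le_mul_of_one_le_left (hepos n hn) (hexp n)
    · intro a ha
      have ha' : a⁻¹ < 1 := inv_lt_one_of_one_lt₀ ha
      filter_upwards [hlim.eventually_const_lt ha'] with n hn
      have h := (lt_div_iff₀ (hEpos n)).1 hn
      have ha0 : 0 < a := by linarith
      rw [inv_mul_lt_iff₀ ha0] at h
      exact h.le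
  constructor
  · rw [Real.exp_sub, div_le_iff₀ (Real.exp_pos _), mul_comm _ (Real.exp (4 * C / n))]
    exact hlow n hn
  · rw [add_comm, Real.exp_add]
    exact hup n hn

/-! ### Behaviour near the origin -/

lemma log_expMoment_near {k : ℕ} (hk : 1 ≤ k) (r : ℕ) {x : ℝ} (hx : x ≤ 0) :
    0 ≤ Real.log (expMoment k r x) + k * x - r * Real.log k ∧
      Real.log (expMoment k r x) + k * x - r * Real.log k ≤ k * Real.exp x := by
  have hkp : (1 : ℝ) ≤ k := by exact_mod_cast hk
  have hM := expMoment_pos hk r x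
  have hkr : (0 : ℝ) < (k : ℝ) ^ r := by positivity
  have hlow : (k : ℝ) ^ r * Real.exp (-(k * x)) ≤ expMoment k r x :=
    Finset.single_le_sum (f := fun j : ℕ => (j : ℝ) ^ r * Real.exp (-(j * x)))
      (fun i _ => by positivity) (Finset.mem_Icc.2 ⟨hk, le_rfl⟩)
  have hup : expMoment k r x ≤ (k : ℝ) ^ r * Real.exp (-(k * x)) * (1 + k * Real.exp x) := by
    have hterm : ∀ j ∈ Finset.Icc 1 k, (j : ℝ) ^ r * Real.exp (-(j * x)) ≤
        (k : ℝ) ^ r * Real.exp (-(k * x)) * ((if j = k then 1 else 0) + Real.exp x) := by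
      intro j hj
      have hjk : (j : ℝ) ≤ k := by exact_mod_cast (Finset.mem_Icc.1 hj).2
      have hp : (j : ℝ) ^ r ≤ (k : ℝ) ^ r := by gcongr
      rw [mul_assoc]
      refine mul_le_mul hp ?_ (Real.exp_pos _).le hkr.le
      split_ifs with h
      · rw [h]
        exact le_mul_of_one_le_right (Real.exp_pos _).le (by linarith [Real.exp_pos x])
      · have : (j : ℝ) + 1 ≤ k := by
          have : j + 1 ≤ k := by have := (Finset.mem_Icc.1 hj).2; omega
          exact_mod_cast this
        rw [zero_add, ← Real.exp_add]
        exact Real.exp_le_exp.2 (by nlinarith)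
    refine (Finset.sum_le_sum hterm).trans (le_of_eq ?_)
    rw [← Finset.mul_sum, Finset.sum_add_distrib]
    simp [hk]
  have hl := Real.log_le_log (by positivity) hlow
  have hu := Real.log_le_log hM hup
  rw [Real.log_mul (by positivity) (Real.exp_pos _).ne', Real.log_exp, Real.log_pow] at hl
  rw [Real.log_mul (by positivity) (by positivity), Real.log_mul (by positivity)
    (Real.exp_pos _).ne', Real.log_exp, Real.log_pow] at hu
  have h1 := Real.log_le_sub_one_of_pos (show 0 < 1 + k * Real.exp x by positivity)
  constructor <;> linarith

lemma log_rateInv_near {k : ℕ} (hk : 1 ≤ k) {x : ℝ} (hx : x ≤ 0) :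
    k * x - (k + 1) * Real.exp x ≤ Real.log (rateInv k x) ∧ Real.log (rateInv k x) ≤ k * x := by
  have hy := rateInv_pos hk x
  have hyt := rateInv_le_exp hk x
  have hl := log_exp_sub_one_rateInv hk x
  obtain ⟨m1, m2⟩ := log_expMoment_near hk 0 hx
  simp only [Nat.cast_zero, zero_mul, sub_zero] at m1 m2
  have he : 0 < Real.exp (rateInv k x) - 1 := by linarith [Real.add_one_le_exp (rateInv k x)]
  have h1 : Real.log (rateInv k x) ≤ Real.log (Real.exp (rateInv k x) - 1) :=
    Real.log_le_log hy (by linarith [Real.add_one_le_exp (rateInv k x)])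
  have h2 : Real.log (Real.exp (rateInv k x) - 1) ≤ Real.log (rateInv k x) + rateInv k x := by
    have : Real.exp (rateInv k x) - 1 ≤ rateInv k x * Real.exp (rateInv k x) := by
      have h := mul_le_mul_of_nonneg_right (Real.add_one_le_exp (-rateInv k x))
        (Real.exp_pos (rateInv k x)).le
      rw [← Real.exp_add, neg_add_cancel, Real.exp_zero] at h
      linarith
    have h := Real.log_le_log he this
    rwa [Real.log_mul hy.ne' (Real.exp_pos _).ne', Real.log_exp] at h
  constructor <;> linarith

lemma exp_mul_rate_near {k : ℕ} (hk : 1 ≤ k) {x : ℝ} (hx : x ≤ 0) :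
    Real.exp (k * x) ≤ Real.exp (k + 1) * rateInv k x ∧
      |rateInv k x - Real.exp (k * x)| ≤ (k + 1) * Real.exp x * Real.exp (k * x) := by
  have hy := rateInv_pos hk x
  obtain ⟨l1, l2⟩ := log_rateInv_near hk hx
  have ht : Real.exp x ≤ 1 := Real.exp_le_one_iff.2 hx
  have hle : rateInv k x ≤ Real.exp (k * x) := (Real.log_le_iff_le_exp hy).1 l2
  constructor
  · rw [← Real.exp_log hy, ← Real.exp_add]
    refine Real.exp_le_exp.2 ?_
    have : ((k : ℝ) + 1) * Real.exp x ≤ (k + 1) * 1 := by gcongr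
    linarith
  · have h1 : Real.exp (k * x) * (1 - (k + 1) * Real.exp x) ≤ rateInv k x := by
      calc _ ≤ Real.exp (k * x) * Real.exp (-((k + 1) * Real.exp x)) := by
            gcongr
            linarith [Real.add_one_le_exp (-((k + 1) * Real.exp x))]
        _ = Real.exp (k * x - (k + 1) * Real.exp x) := by rw [← Real.exp_add]; congr 1
        _ ≤ Real.exp (Real.log (rateInv k x)) := Real.exp_le_exp.2 l1
        _ = _ := Real.exp_log hy
    rw [abs_of_nonpos (by linarith)]
    linarith

/-- Near `y = 0`, where `e^{ℓ(y)}` is of the order of `y^{1/k}`, the approximate solution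
`D(y) = E(y) / (e^y - 1)` of the recurrence for `d` has the shape of an inverse Gamma function of
`y / (ks)`. -/
lemma logApprox_near_zero {k : ℕ} (hk : 1 ≤ k) :
    ∃ C : ℝ, 0 < C ∧ ∀ s y : ℝ, 0 < s → 0 < y → rate k y ≤ 0 →
      |logApprox k s y - Real.log (Real.exp y - 1)
        - (-(Real.pi ^ 2 / (3 * (k * (k + 1)))) / s - y * (Real.log y - 1) / (k * s)
          - Real.log k / 2 - Real.log y / 2)| ≤ C * (1 + y / s) * Real.exp (rate k y) := by
  have hkp : (1 : ℝ) ≤ k := by exact_mod_cast hk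
  set c : ℝ := (k + 1) + (3 + (k + 1)) * Real.exp (k + 1) with hc
  refine ⟨c + 2 * (k + 1), by positivity, fun s y hs hy hx => ?_⟩
  set x := rate k y with hxdef
  have hyx : rateInv k x = y := rateInv_rate hk hy
  set t := Real.exp x with ht
  have htp : 0 < t := Real.exp_pos x
  obtain ⟨l1, l2⟩ := log_rateInv_near hk hx
  obtain ⟨e1, e2⟩ := exp_mul_rate_near hk hx
  obtain ⟨m1, m2⟩ := log_expMoment_near hk 0 hx
  obtain ⟨n1, n2⟩ := log_expMoment_near hk 1 hx
  have hP := abs_ratePotential_sub_le hk hx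
  have hl := log_exp_sub_one_rateInv hk x
  have hadd : Real.exp ((k + 1) * x) = t * Real.exp (k * x) := by
    rw [ht, ← Real.exp_add]; congr 1; ring
  rw [hadd] at hP
  rw [hyx] at l1 l2 e1 e2 hl
  simp only [Nat.cast_zero, zero_mul, sub_zero, Nat.cast_one, one_mul] at m1 m2 n1 n2
  -- the exponential part
  set A := (x * y - ratePotential k x) - y * (Real.log y - 1) / k with hA
  have hA' : |A| ≤ c * t * y := by
    have d1 : |y * ((k * x - Real.log y) / k)| ≤ y * ((k + 1) * t) := by
      rw [abs_mul, abs_of_pos hy, abs_div, abs_of_pos (show (0 : ℝ) < k by linarith),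
        abs_of_nonneg (by linarith)]
      gcongr
      exact (div_le_self (by linarith) hkp).trans (by linarith)
    have d2 : |(y - Real.exp (k * x)) / k| ≤ (k + 1) * t * Real.exp (k * x) := by
      rw [abs_div, abs_of_pos (show (0 : ℝ) < k by linarith)]
      exact (div_le_self (abs_nonneg _) hkp).trans e2
    have eA : A = y * ((k * x - Real.log y) / k) + (y - Real.exp (k * x)) / k
        - (ratePotential k x - Real.exp (k * x) / k) := by
      rw [hA]
      field_simp
      ring
    rw [eA]
    refine (abs_sub _ _).trans ((add_le_add_left (abs_add_le _ _) _).trans ?_)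
    have h3 : (3 + (k + 1)) * t * Real.exp (k * x) ≤ (3 + (k + 1)) * t * (Real.exp (k + 1) * y) := by
      gcongr
    rw [hc]
    linarith
  -- the amplitude
  set B := logAmp k y - Real.log (Real.exp y - 1) + Real.log k / 2 + Real.log y / 2 with hB
  have hB' : |B| ≤ 2 * (k + 1) * t := by
    have eB : B = -(Real.log (expMoment k 1 x) + k * x - Real.log k) / 2
        + (Real.log (expMoment k 0 x) + k * x) - (k * x - Real.log y) / 2 := by
      rw [hB, hl]
      simp only [logAmp, ← hxdef]
      ring
    rw [eB, abs_le]
    constructor <;> nlinarith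
  have e : logApprox k s y - Real.log (Real.exp y - 1)
        - (-(Real.pi ^ 2 / (3 * (k * (k + 1)))) / s - y * (Real.log y - 1) / (k * s)
          - Real.log k / 2 - Real.log y / 2) = -(A / s) + B := by
    rw [hA, hB]
    simp only [logApprox, action, ← hxdef]
    field_simp
    ring
  rw [e]
  calc _ ≤ |A| / s + |B| := by
        refine (abs_add_le _ _).trans ?_
        rw [abs_neg, abs_div, abs_of_pos hs]
    _ ≤ c * t * y / s + 2 * (k + 1) * t := by gcongr
    _ = c * (y / s) * t + 2 * (k + 1) * t := by ring
    _ ≤ (c + 2 * (k + 1)) * (y / s) * t + (c + 2 * (k + 1)) * t := by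
        have : 0 < c := by positivity
        gcongr <;> linarith
    _ = _ := by ring

lemma rate_le_rate {k : ℕ} (hk : 1 ≤ k) {a b : ℝ} (ha : 0 < a) (hab : a ≤ b) :
    rate k a ≤ rate k b :=
  (strictMonoOn_rate hk).monotoneOn ha (ha.trans_le hab) hab

/-- Where the rate is very negative the recurrence is dominated by its longest step. -/
lemma IsRecSol.step_le {k : ℕ} (hk : 1 ≤ k) :
    ∃ C : ℝ, 0 < C ∧ ∀ s : ℝ, 0 < s → s ≤ 1 → ∀ d : ℕ → ℝ, IsRecSol k s d → ∀ i : ℕ,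
      rate k ((i + k : ℕ) * s) ≤ 0 →
      d i ≤ (Real.exp ((i + k : ℕ) * s) - 1) * d (i + k)
        * (1 + C * Real.exp (rate k ((i + k : ℕ) * s))) := by
  obtain ⟨C1, hC1, hcmp⟩ := IsRecSol.compare hk
  obtain ⟨C2, hC2, hstep⟩ := logApprox_step hk
  refine ⟨k * Real.exp (C1 + (k : ℝ) ^ 2 + C2 + C1), by positivity,
    fun s hs hs1 d hd i hx => ?_⟩
  set t := Real.exp (rate k ((i + k : ℕ) * s)) with ht
  set e : ℕ → ℝ := fun n => (Real.exp (n * s) - 1) * d n with he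
  have he0 : ∀ n, 0 ≤ e n := fun n =>
    mul_nonneg (by linarith [Real.one_le_exp (show 0 ≤ (n : ℝ) * s by positivity)]) (hd.nonneg n)
  have hdiv : ∀ n : ℕ, 1 ≤ n → C1 / n ≤ C1 := fun n hn =>
    div_le_self hC1.le (by exact_mod_cast hn)
  have hterm : ∀ j ∈ Finset.Icc 1 k, e (i + j) ≤
      (if j = k then e (i + k) else 0) + Real.exp (C1 + (k : ℝ) ^ 2 + C2 + C1) * t * e (i + k) := by
    intro j hj
    obtain ⟨hj1, hjk⟩ := Finset.mem_Icc.1 hj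
    have hpos : 0 ≤ Real.exp (C1 + (k : ℝ) ^ 2 + C2 + C1) * t * e (i + k) := by
      have := he0 (i + k)
      positivity
    split_ifs with h
    · rw [h]; linarith
    · have hn1 : 1 ≤ i + j := by omega
      have hy : (0 : ℝ) < (i + j : ℕ) * s := by
        have : (0 : ℝ) < (i + j : ℕ) := by exact_mod_cast hn1
        positivity
      have hmem : k - j ∈ Finset.Icc 1 k := Finset.mem_Icc.2 ⟨by omega, by omega⟩
      have h1 := (abs_le.1 (hstep s ((i + j : ℕ) * s) hs hy (k - j) hmem)).1
      have h2 := (abs_le.1 (abs_stepCoeff_le hk hs hs1 hn1 hmem)).1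
      have hcast : ((i + j : ℕ) : ℝ) * s + ((k - j : ℕ) : ℝ) * s = (i + k : ℕ) * s := by
        rw [← add_mul, ← Nat.cast_add]
        congr 2
        omega
      rw [hcast] at h1
      have h3 : C2 * (s ^ 2 / ((i + j : ℕ) * s) ^ 2) ≤ C2 := by
        have hn2 : (1 : ℝ) ≤ (i + j : ℕ) := by exact_mod_cast hn1
        have : s ^ 2 / ((i + j : ℕ) * s) ^ 2 ≤ 1 := by
          rw [mul_pow, div_le_one (by positivity)]
          exact le_mul_of_one_le_left (by positivity) (one_le_pow₀ hn2)
        nlinarith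
      have hmono : rate k ((i + j : ℕ) * s) ≤ rate k ((i + k : ℕ) * s) := by
        refine rate_le_rate hk hy ?_
        gcongr
      have hkj : (1 : ℝ) ≤ (k - j : ℕ) := by
        have : 1 ≤ k - j := by omega
        exact_mod_cast this
      have h4 : ((k - j : ℕ) : ℝ) * rate k ((i + j : ℕ) * s) ≤ rate k ((i + k : ℕ) * s) := by
        nlinarith
      have hup := (hcmp s hs hs1 d hd (i + j) hn1).2
      have hlow := (hcmp s hs hs1 d hd (i + k) (by omega)).1
      calc e (i + j) ≤ Real.exp (logApprox k s ((i + j : ℕ) * s) + C1 / (i + j : ℕ)) := hup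
        _ ≤ Real.exp ((C1 + (k : ℝ) ^ 2 + C2 + C1) + rate k ((i + k : ℕ) * s)
            + (logApprox k s ((i + k : ℕ) * s) - C1 / (i + k : ℕ))) := by
            refine Real.exp_le_exp.2 ?_
            have := hdiv (i + j) hn1
            have := hdiv (i + k) (by omega)
            linarith
        _ = Real.exp (C1 + (k : ℝ) ^ 2 + C2 + C1) * t *
            Real.exp (logApprox k s ((i + k : ℕ) * s) - C1 / (i + k : ℕ)) := by
            rw [Real.exp_add, Real.exp_add, ← ht]
        _ ≤ _ := by
            rw [zero_add]
            gcongr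
  rw [hd.eq_sum i]
  refine (Finset.sum_le_sum hterm).trans (le_of_eq ?_)
  rw [Finset.sum_add_distrib]
  simp only [Finset.sum_ite_eq', Finset.mem_Icc, hk, le_refl, and_self, if_true,
    Finset.sum_const, Nat.card_Icc, Nat.add_sub_cancel, nsmul_eq_mul]
  simp only [he]
  ring

lemma IsRecSol.le_step {k : ℕ} (hk : 1 ≤ k) {s : ℝ} (hs : 0 < s) {d : ℕ → ℝ}
    (hd : IsRecSol k s d) (i : ℕ) :
    (Real.exp ((i + k : ℕ) * s) - 1) * d (i + k) ≤ d i := by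
  rw [hd.eq_sum i]
  refine Finset.single_le_sum (f := fun j => (Real.exp ((i + j : ℕ) * s) - 1) * d (i + j))
    (fun j _ => mul_nonneg ?_ (hd.nonneg _)) (Finset.mem_Icc.2 ⟨hk, le_rfl⟩)
  linarith [Real.one_le_exp (show 0 ≤ ((i + j : ℕ) : ℝ) * s by positivity)]

/-- Iterating the longest step: `d 0 ≈ (ks)^m m! d (km)`. -/
lemma IsRecSol.zero_bounds {k : ℕ} (hk : 1 ≤ k) :
    ∃ C : ℝ, 0 < C ∧ ∀ s : ℝ, 0 < s → s ≤ 1 → ∀ d : ℕ → ℝ, IsRecSol k s d → ∀ m : ℕ, 1 ≤ m →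
      rate k ((k * m : ℕ) * s) ≤ 0 →
      (k * s) ^ m * m.factorial * d (k * m) ≤ d 0 ∧
      d 0 ≤ (k * s) ^ m * m.factorial * d (k * m)
        * Real.exp (C * m * Real.exp (rate k ((k * m : ℕ) * s))) := by
  obtain ⟨C, hC, hstep⟩ := IsRecSol.step_le hk
  have hkp : (1 : ℝ) ≤ k := by exact_mod_cast hk
  refine ⟨1 + C, by positivity, fun s hs hs1 d hd m hm hx => ⟨?_, ?_⟩⟩
  · clear hx hm
    induction m with
    | zero => simp
    | succ m ih =>
      refine le_trans ?_ ih
      have h := hd.le_step hk hs (k * m)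
      have h2 : k * s * (m + 1) ≤ Real.exp ((k * m + k : ℕ) * s) - 1 := by
        have := Real.add_one_le_exp (((k * m + k : ℕ) : ℝ) * s)
        push_cast at this ⊢
        linarith
      have h3 := hd.nonneg (k * m + k)
      calc _ = (k * s) ^ m * m.factorial * ((k * s * (m + 1)) * d (k * m + k)) := by
            rw [Nat.factorial_succ, Nat.mul_succ]; push_cast; ring
        _ ≤ (k * s) ^ m * m.factorial * ((Real.exp ((k * m + k : ℕ) * s) - 1) * d (k * m + k)) := by
            gcongr
        _ ≤ _ := by gcongr
  · set t := Real.exp (rate k ((k * m : ℕ) * s)) with ht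
    have key : ∀ l : ℕ, l ≤ m → d 0 ≤ (k * s) ^ l * l.factorial * d (k * l)
        * Real.exp ((1 + C) * l * t) := by
      intro l
      induction l with
      | zero => intro _; simp
      | succ l ih =>
        intro hl
        have hlm : k * l + k ≤ k * m := by rw [← Nat.mul_succ]; exact Nat.mul_le_mul_left k hl
        have hy : (0 : ℝ) < (k * l + k : ℕ) * s := by
          have : (0 : ℝ) < (k * l + k : ℕ) := by exact_mod_cast (by omega : 0 < k * l + k)
          positivity
        have hmono : rate k ((k * l + k : ℕ) * s) ≤ rate k ((k * m : ℕ) * s) := by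
          refine rate_le_rate hk hy ?_
          gcongr
        have h := hstep s hs hs1 d hd (k * l) (hmono.trans hx)
        have hexp : Real.exp (rate k ((k * l + k : ℕ) * s)) ≤ t := Real.exp_le_exp.2 hmono
        have hyt : ((k * l + k : ℕ) : ℝ) * s ≤ t := by
          refine le_trans ?_ hexp
          have := rateInv_le_exp hk (rate k ((k * l + k : ℕ) * s))
          rwa [rateInv_rate hk hy] at this
        have hd0 := hd.nonneg (k * l + k)
        have h2 : Real.exp ((k * l + k : ℕ) * s) - 1 ≤ k * s * (l + 1) * Real.exp t := by
          set y := ((k * l + k : ℕ) : ℝ) * s with hydef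
          have hye : k * s * (l + 1) = y := by rw [hydef]; push_cast; ring
          have h := mul_le_mul_of_nonneg_right (Real.add_one_le_exp (-y)) (Real.exp_pos y).le
          rw [← Real.exp_add, neg_add_cancel, Real.exp_zero] at h
          rw [hye]
          calc _ ≤ y * Real.exp y := by linarith
            _ ≤ _ := by gcongr
        have h1 : d (k * l) ≤ k * s * (l + 1) * Real.exp t * d (k * l + k) * Real.exp (C * t) := by
          refine h.trans ?_
          have h4 : 1 + C * Real.exp (rate k ((k * l + k : ℕ) * s)) ≤ Real.exp (C * t) := by
            refine le_trans ?_ (Real.add_one_le_exp _)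
            rw [add_comm]
            gcongr
          gcongr
        calc d 0 ≤ (k * s) ^ l * l.factorial * d (k * l) * Real.exp ((1 + C) * l * t) :=
              ih (by omega)
          _ ≤ (k * s) ^ l * l.factorial * (k * s * (l + 1) * Real.exp t * d (k * l + k)
              * Real.exp (C * t)) * Real.exp ((1 + C) * l * t) := by gcongr
          _ = (k * s) ^ l * l.factorial * (k * s * (l + 1)) * d (k * l + k)
              * (Real.exp t * Real.exp (C * t) * Real.exp ((1 + C) * l * t)) := by ring
          _ = _ := by
              rw [← Real.exp_add, ← Real.exp_add, Nat.factorial_succ, Nat.mul_succ]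
              push_cast
              rw [show t + C * t + (1 + C) * l * t = (1 + C) * (l + 1) * t by ring]
              ring
    exact key m le_rfl

/-! ### Matching at an intermediate site -/

/-- Stirling's formula with a rate. -/
lemma log_factorial_le {m : ℕ} (hm : 1 ≤ m) :
    Real.log m.factorial ≤ m * Real.log m - m + Real.log m / 2 + Real.log (2 * Real.pi) / 2
      + 1 / m := by
  have hmono : Monotone fun n : ℕ => Real.log (Stirling.stirlingSeq (n + 1)) - 1 / (12 * (n + 1)) := by
    refine monotone_nat_of_le_succ fun n => ?_
    have h := Stirling.log_stirlingSeq_sdiff_le (n + 1)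
    have e : (1 : ℝ) / (12 * (n + 1)) - 1 / (12 * ((n + 1 : ℕ) + 1))
        = 1 / (12 * (n + 1 : ℕ) * ((n + 1 : ℕ) + 1)) := by
      push_cast
      field_simp
      ring
    linarith
  have hlim : Tendsto (fun n : ℕ => Real.log (Stirling.stirlingSeq (n + 1)) - 1 / (12 * ((n : ℝ) + 1)))
      atTop (𝓝 (Real.log (√Real.pi) - 1 / 12 * 0)) := by
    refine Tendsto.sub ?_ ?_
    · exact ((tendsto_add_atTop_iff_nat 1).2 Stirling.tendsto_stirlingSeq_sqrt_pi).log
        (Real.sqrt_pos.2 Real.pi_pos).ne'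
    · refine (tendsto_one_div_add_atTop_nhds_zero_nat.const_mul (1 / 12 : ℝ)).congr fun n => ?_
      field_simp
  obtain ⟨n, rfl⟩ : ∃ n, m = n + 1 := ⟨m - 1, by omega⟩
  have h := hmono.ge_of_tendsto hlim n
  have hf := Stirling.log_stirlingSeq_formula (n + 1)
  have hn : (0 : ℝ) < (n + 1 : ℕ) := by positivity
  rw [Real.log_mul two_ne_zero hn.ne', Real.log_div hn.ne' (Real.exp_pos _).ne', Real.log_exp] at hf
  rw [Real.log_sqrt Real.pi_pos.le] at h
  rw [Real.log_mul two_ne_zero Real.pi_pos.ne']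
  have h1 : (1 : ℝ) / (12 * (n + 1)) ≤ 1 / (n + 1 : ℕ) := by
    push_cast
    refine one_div_le_one_div_of_le (by positivity) ?_
    linarith [(Nat.cast_nonneg n : (0 : ℝ) ≤ n)]
  linarith

/-- The value at the origin, in terms of a site `km` at which the two descriptions of the
solution are matched. -/
lemma IsRecSol.log_zero_matching {k : ℕ} (hk : 1 ≤ k) :
    ∃ C : ℝ, 0 < C ∧ ∀ s : ℝ, 0 < s → s ≤ 1 → ∀ d : ℕ → ℝ, IsRecSol k s d → ∀ m : ℕ, 1 ≤ m →
      rate k ((k * m : ℕ) * s) ≤ 0 → 0 < d 0 ∧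
      |Real.log (d 0) - (-(Real.pi ^ 2 / (3 * (k * (k + 1)))) / s
          + Real.log (2 * Real.pi / s) / 2 - Real.log k)|
        ≤ C * (1 / m + m * Real.exp (rate k ((k * m : ℕ) * s))) := by
  obtain ⟨C1, hC1, hcmp⟩ := IsRecSol.compare hk
  obtain ⟨C2, hC2, hnear⟩ := logApprox_near_zero hk
  obtain ⟨C3, hC3, hzero⟩ := IsRecSol.zero_bounds hk
  have hkp : (1 : ℝ) ≤ k := by exact_mod_cast hk
  refine ⟨C1 + 1 + C2 * (2 * k) + C3, by positivity, fun s hs hs1 d hd m hm hx => ?_⟩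
  set n := k * m with hn
  have hmp : (1 : ℝ) ≤ m := by exact_mod_cast hm
  have hn1 : 1 ≤ n := Nat.mul_pos hk hm
  have hncast : (n : ℝ) = k * m := by rw [hn]; push_cast; ring
  have hnm : (m : ℝ) ≤ n := by rw [hncast]; nlinarith
  have hy : 0 < n * s := by
    have : (0 : ℝ) < n := by linarith
    positivity
  set t := Real.exp (rate k (n * s)) with ht
  have htp : 0 < t := Real.exp_pos _
  have hw := exp_sub_one_pos hn1 hs
  obtain ⟨c1, c2⟩ := hcmp s hs hs1 d hd n hn1
  obtain ⟨z1, z2⟩ := hzero s hs hs1 d hd m hm hx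
  have hnr := abs_le.1 (hnear s (n * s) hs hy hx)
  have hdn : 0 < d n := by
    have := (Real.exp_pos _).trans_le c1
    exact pos_of_mul_pos_right this hw.le
  have hpre : 0 < (k * s) ^ m * (m.factorial : ℝ) := by positivity
  have hd0 : 0 < d 0 := (mul_pos hpre hdn).trans_le z1
  refine ⟨hd0, ?_⟩
  have l1 := Real.log_le_log (Real.exp_pos _) c1
  have l2 := Real.log_le_log (mul_pos hw hdn) c2
  rw [Real.log_exp, Real.log_mul hw.ne' hdn.ne'] at l1
  rw [Real.log_exp, Real.log_mul hw.ne' hdn.ne'] at l2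
  have l3 := Real.log_le_log (mul_pos hpre hdn) z1
  have l4 := Real.log_le_log hd0 z2
  have hks : (0 : ℝ) < k * s := by positivity
  have hfac : (0 : ℝ) < m.factorial := by positivity
  have elog : Real.log ((k * s) ^ m * m.factorial * d n)
      = m * (Real.log k + Real.log s) + Real.log m.factorial + Real.log (d n) := by
    rw [Real.log_mul hpre.ne' hdn.ne', Real.log_mul (by positivity) hfac.ne', Real.log_pow,
      Real.log_mul (by positivity) hs.ne']
  rw [Real.log_mul (mul_pos hpre hdn).ne' (Real.exp_pos _).ne', Real.log_exp, elog] at l4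
  rw [elog] at l3
  have st1 := Stirling.le_log_factorial_stirling (n := m) (by omega)
  have st2 := log_factorial_le hm
  have hlogn : Real.log (n * s) = Real.log k + Real.log m + Real.log s := by
    rw [hncast, Real.log_mul (by positivity) hs.ne', Real.log_mul (by positivity) (by positivity)]
  have hfrac : n * s * (Real.log (n * s) - 1) / (k * s)
      = m * (Real.log k + Real.log m + Real.log s - 1) := by
    rw [hlogn, hncast]
    field_simp
  have hys : n * s / s = n := by field_simp
  rw [hfrac, hlogn, hys] at hnr
  have hpi : Real.log (2 * Real.pi / s) = Real.log (2 * Real.pi) - Real.log s :=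
    Real.log_div (by positivity) hs.ne'
  have b1 : C1 / n ≤ C1 * (1 / m) := by
    rw [mul_one_div]
    gcongr
  have b2 : C2 * (1 + n) * t ≤ C2 * (2 * k) * (m * t) := by
    have : 1 + (n : ℝ) ≤ 2 * (k * m) := by rw [hncast]; nlinarith
    calc C2 * (1 + n) * t ≤ C2 * (2 * (k * m)) * t := by gcongr
      _ = _ := by ring
  have p1 : 0 < C1 * (m * t) := by positivity
  have p2 : 0 < C2 * (2 * k) * (1 / m) := by positivity
  have p3 : 0 < C3 * (1 / m) := by positivity
  have p4 : 0 < C3 * m * t := by positivity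
  have p5 : (0 : ℝ) < 1 / m := by positivity
  have p6 : 0 < m * t := by positivity
  have etot : (C1 + 1 + C2 * (2 * k) + C3) * (1 / m + m * t)
      = C1 * (1 / m) + C1 * (m * t) + 1 / m + m * t + C2 * (2 * k) * (1 / m)
        + C2 * (2 * k) * (m * t) + C3 * (1 / m) + C3 * m * t := by ring
  rw [etot, hpi, abs_le]
  obtain ⟨r1, r2⟩ := hnr
  constructor <;> linarith

/-- The value at the origin of solutions of the recurrence, for small `s`. The error terms `1 / m` and
`m e^{ℓ(kms)}` are balanced by the choice of `m`. -/
theorem IsRecSol.log_zero {k : ℕ} (hk : 1 ≤ k) :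
    ∃ C : ℝ, 0 < C ∧ ∀ᶠ s : ℝ in 𝓝[>] 0, ∀ d : ℕ → ℝ, IsRecSol k s d → 0 < d 0 ∧
      |Real.log (d 0) - (-(Real.pi ^ 2 / (3 * (k * (k + 1)))) / s
          + Real.log (2 * Real.pi / s) / 2 - Real.log k)| ≤ C * s ^ (1 / (2 * (k : ℝ) + 3)) := by
  obtain ⟨C, hC, hmatch⟩ := IsRecSol.log_zero_matching hk
  have hkp : (1 : ℝ) ≤ k := by exact_mod_cast hk
  set β : ℝ := 1 / (2 * (k : ℝ) + 3) with hβ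
  have hβ0 : 0 < β := by positivity
  have hβ1 : (2 * k + 3) * β = 1 := by rw [hβ]; field_simp
  have hβlt : 0 < 1 - β := by nlinarith
  refine ⟨C * (1 + 4 * k * Real.exp 2), by positivity, ?_⟩
  have hsmall : ∀ᶠ s : ℝ in 𝓝[>] 0, 2 * k * s ^ (1 - β) < rateInv k 0 := by
    have h := (Real.continuousAt_rpow_const 0 (1 - β) (Or.inr hβlt.le)).tendsto.const_mul
      (2 * (k : ℝ))
    rw [Real.zero_rpow hβlt.ne', mul_zero] at h
    exact (h.mono_left nhdsWithin_le_nhds).eventually_lt_const (rateInv_pos hk 0)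
  filter_upwards [hsmall, self_mem_nhdsWithin,
    (eventually_le_nhds (show (0 : ℝ) < 1 by norm_num)).filter_mono nhdsWithin_le_nhds]
    with s hsm hs hs1 d hd
  have hs : 0 < s := hs
  have hone : 1 ≤ s ^ (-β) := Real.one_le_rpow_of_pos_of_le_one_of_nonpos hs hs1 (by linarith)
  -- the matching site: `m ≍ s ^ (-β)`
  set m := ⌈s ^ (-β)⌉₊ with hm
  have hm1 : s ^ (-β) ≤ m := Nat.le_ceil _
  have hm2 : (m : ℝ) ≤ 2 * s ^ (-β) := by
    have := (Nat.ceil_lt_add_one (show 0 ≤ s ^ (-β) by positivity)).le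
    linarith
  have hm0 : 1 ≤ m := by exact_mod_cast hone.trans hm1
  have hmp : (1 : ℝ) ≤ m := by exact_mod_cast hm0
  set y : ℝ := (k * m : ℕ) * s with hy
  have hye : y = k * m * s := by rw [hy]; push_cast; ring
  have hyp : 0 < y := by rw [hye]; positivity
  have hyle : y ≤ 2 * k * s ^ (1 - β) := by
    calc y = k * s * m := by rw [hye]; ring
      _ ≤ k * s * (2 * s ^ (-β)) := by gcongr
      _ = 2 * k * (s ^ (1 : ℝ) * s ^ (-β)) := by rw [Real.rpow_one]; ring
      _ = _ := by rw [← Real.rpow_add hs]; rfl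
  have hrate : rate k y ≤ 0 := by
    rw [← (strictMono_rateInv hk).le_iff_le, rateInv_rate hk hyp]
    linarith
  obtain ⟨h0, hb⟩ := hmatch s hs hs1 d hd m hm0 hrate
  refine ⟨h0, hb.trans ?_⟩
  rw [mul_assoc]
  refine mul_le_mul_of_nonneg_left ?_ hC.le
  have hinv : 1 / (m : ℝ) ≤ s ^ β := by
    rw [div_le_iff₀ (by linarith)]
    calc (1 : ℝ) = s ^ β * s ^ (-β) := by rw [← Real.rpow_add hs, add_neg_cancel, Real.rpow_zero]
      _ ≤ _ := by gcongr
  have hexp : Real.exp (rate k y) ≤ Real.exp 2 * (2 * k * s ^ (2 * β)) := by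
    have hl := (log_rateInv_near hk hrate).1
    rw [rateInv_rate hk hyp] at hl
    have ht1 : Real.exp (rate k y) ≤ 1 := Real.exp_le_one_iff.2 hrate
    have hle : rate k y ≤ 2 + Real.log y * (1 / k) := by
      have : (k : ℝ) * rate k y ≤ k * (2 + Real.log y * (1 / k)) := by
        have e : (k : ℝ) * (2 + Real.log y * (1 / k)) = 2 * k + Real.log y := by field_simp
        rw [e]
        nlinarith
      exact le_of_mul_le_mul_left this (by linarith)
    calc Real.exp (rate k y) ≤ Real.exp (2 + Real.log y * (1 / k)) := Real.exp_le_exp.2 hle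
      _ = Real.exp 2 * y ^ (1 / (k : ℝ)) := by rw [Real.exp_add, ← Real.rpow_def_of_pos hyp]
      _ ≤ Real.exp 2 * (2 * k * s ^ (1 - β)) ^ (1 / (k : ℝ)) := by gcongr
      _ = Real.exp 2 * ((2 * k : ℝ) ^ (1 / (k : ℝ)) * s ^ ((1 - β) * (1 / k))) := by
          rw [Real.mul_rpow (by positivity) (by positivity), ← Real.rpow_mul hs.le]
      _ ≤ Real.exp 2 * ((2 * k : ℝ) ^ (1 : ℝ) * s ^ (2 * β)) := by
          have h1 : (2 * k : ℝ) ^ (1 / (k : ℝ)) ≤ (2 * k : ℝ) ^ (1 : ℝ) :=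
            Real.rpow_le_rpow_of_exponent_le (by linarith)
              ((div_le_one (by linarith)).2 hkp)
          have h2 : s ^ ((1 - β) * (1 / k)) ≤ s ^ (2 * β) := by
            refine Real.rpow_le_rpow_of_exponent_ge hs hs1 ?_
            rw [mul_one_div (1 - β), le_div_iff₀ (by linarith)]
            linarith
          gcongr
      _ = _ := by rw [Real.rpow_one]
  have hmt : m * Real.exp (rate k y) ≤ 4 * k * Real.exp 2 * s ^ β := by
    calc _ ≤ 2 * s ^ (-β) * (Real.exp 2 * (2 * k * s ^ (2 * β))) := by gcongr
      _ = 4 * k * Real.exp 2 * (s ^ (-β) * s ^ (2 * β)) := by ring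
      _ = _ := by rw [← Real.rpow_add hs]; congr 2; ring
  linarith

/-! ### Generating functions of partitions -/

open scoped ENNReal

/-- All of `a, …, a + k - 1` occur in `m`, for some `a`. -/
def Multiset.HasRun (k : ℕ) (m : Multiset ℕ) : Prop := ∃ a : ℕ, ∀ i < k, a + i ∈ m

/-- Partitions of arbitrary numbers all of whose parts exceed `n`. -/
abbrev PartsAbove (n : ℕ) : Type := {m : Multiset ℕ // ∀ i ∈ m, n < i}

/-- Splitting off the parts of size `n + 1`. -/
def partsAboveEquiv (n : ℕ) : ℕ × PartsAbove (n + 1) ≃ PartsAbove n where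
  toFun p := ⟨Multiset.replicate p.1 (n + 1) + p.2.1, fun i hi => by
    rcases Multiset.mem_add.1 hi with h | h
    · rw [Multiset.eq_of_mem_replicate h]; omega
    · exact (Nat.lt_succ_self n).trans (p.2.2 i h)⟩
  invFun m := (m.1.count (n + 1), ⟨m.1.filter (n + 1 < ·), fun i hi => (Multiset.mem_filter.1 hi).2⟩)
  left_inv p := by
    obtain ⟨c, m, hm⟩ := p
    have h1 : m.count (n + 1) = 0 := Multiset.count_eq_zero.2 fun h => (hm _ h).false
    have h2 : m.filter (n + 1 < ·) = m := Multiset.filter_eq_self.2 hm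
    have h3 : (Multiset.replicate c (n + 1)).filter (n + 1 < ·) = 0 :=
      Multiset.filter_eq_nil.2 fun a ha => by rw [Multiset.eq_of_mem_replicate ha]; omega
    simp [h1, h2, h3]
  right_inv m := by
    obtain ⟨m, hm⟩ := m
    apply Subtype.ext
    simp only
    rw [← Multiset.filter_eq']
    have h : m.filter (n + 1 < ·) = m.filter (fun a => ¬ a = n + 1) :=
      Multiset.filter_congr fun a ha => by have := hm a ha; omega
    rw [h, Multiset.filter_add_not]

open Classical in
/-- The generating function, in the extended nonnegative reals, of the partitions with all parts
exceeding `n` and with property `P`. -/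
noncomputable def genSum (q : ℝ≥0∞) (n : ℕ) (P : Multiset ℕ → Prop) : ℝ≥0∞ :=
  ∑' m : PartsAbove n, if P m.1 then q ^ m.1.sum else 0

lemma genSum_congr {q : ℝ≥0∞} {n : ℕ} {P Q : Multiset ℕ → Prop}
    (h : ∀ m : Multiset ℕ, (∀ i ∈ m, n < i) → (P m ↔ Q m)) : genSum q n P = genSum q n Q := by
  unfold genSum
  refine tsum_congr fun m => ?_
  by_cases hP : P m.1
  · rw [if_pos hP, if_pos ((h m.1 m.2).1 hP)]
  · rw [if_neg hP, if_neg fun hQ => hP ((h m.1 m.2).2 hQ)]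

lemma genSum_mono {q : ℝ≥0∞} {n : ℕ} {P Q : Multiset ℕ → Prop} (h : ∀ m, P m → Q m) :
    genSum q n P ≤ genSum q n Q := by
  unfold genSum
  refine ENNReal.tsum_le_tsum fun m => ?_
  split_ifs with h1 h2
  · exact le_rfl
  · exact absurd (h _ h1) h2
  · exact zero_le
  · exact le_rfl

lemma one_le_genSum {q : ℝ≥0∞} {n : ℕ} {P : Multiset ℕ → Prop} (h : P 0) : 1 ≤ genSum q n P := by
  unfold genSum
  refine le_trans ?_ (ENNReal.le_tsum (⟨0, by simp⟩ : PartsAbove n))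
  simp [h]

lemma genSum_split (q : ℝ≥0∞) (n : ℕ) (P : Multiset ℕ → Prop) :
    genSum q n P = ∑' c : ℕ, (q ^ (n + 1)) ^ c *
      genSum q (n + 1) (fun m => P (Multiset.replicate c (n + 1) + m)) := by
  classical
  unfold genSum
  rw [← (partsAboveEquiv n).tsum_eq, ENNReal.tsum_prod (f := fun c m =>
    if P (partsAboveEquiv n (c, m)).1 then q ^ (partsAboveEquiv n (c, m)).1.sum else 0)]
  refine tsum_congr fun c => ?_
  rw [← ENNReal.tsum_mul_left]
  refine tsum_congr fun m => ?_
  simp only [partsAboveEquiv, Equiv.coe_fn_mk, mul_ite, mul_zero]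
  refine if_congr Iff.rfl ?_ rfl
  rw [Multiset.sum_add, Multiset.sum_replicate, pow_add, smul_eq_mul, mul_comm c, pow_mul]

lemma genSum_split_of_iff (q : ℝ≥0∞) (n : ℕ) (P : Multiset ℕ → Prop)
    (h : ∀ c m, P (Multiset.replicate c (n + 1) + m) ↔ P m) :
    genSum q n P = (1 - q ^ (n + 1))⁻¹ * genSum q (n + 1) P := by
  rw [genSum_split, ← ENNReal.tsum_geometric, ← ENNReal.tsum_mul_right]
  exact tsum_congr fun c => by rw [genSum_congr fun m _ => h c m]

/-- `q^n / (1 - q^n)`: the weight of the presence of parts of size `n`. -/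
noncomputable def partWeight (r : ℝ) (n : ℕ) : ℝ := r ^ n / (1 - r ^ n)


lemma one_sub_pow_pos {r : ℝ} (hr0 : 0 < r) (hr1 : r < 1) (n : ℕ) : 0 < 1 - r ^ (n + 1) := by
  have := pow_lt_one₀ hr0.le hr1 n.add_one_ne_zero
  linarith

lemma ennreal_inv_one_sub_pow {r : ℝ} (hr0 : 0 < r) (hr1 : r < 1) (n : ℕ) :
    (1 - ENNReal.ofReal r ^ (n + 1))⁻¹ = ENNReal.ofReal (1 - r ^ (n + 1))⁻¹ := by
  have h := one_sub_pow_pos hr0 hr1 n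
  rw [ENNReal.ofReal_inv_of_pos h, ENNReal.ofReal_sub _ (by positivity), ENNReal.ofReal_one,
    ENNReal.ofReal_pow hr0.le]

/-- Conditioning on the presence of `n + 1`, for partitions without run in which moreover not all of
`n + 1, …, n + j + 1` occur: either `n + 1` is not a part, or it is, and the run
starting there has to stop one step earlier. -/
lemma genSum_run_step {r : ℝ} (hr0 : 0 < r) (hr1 : r < 1) {k j : ℕ} (hj : j + 1 ≤ k) (n : ℕ) :
    genSum (ENNReal.ofReal r) n (fun m => ¬ m.HasRun k ∧ ∃ i < j + 1, n + 1 + i ∉ m)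
      = genSum (ENNReal.ofReal r) (n + 1) (fun m => ¬ m.HasRun k)
        + ENNReal.ofReal (partWeight r (n + 1)) *
          genSum (ENNReal.ofReal r) (n + 1)
            (fun m => ¬ m.HasRun k ∧ ∃ i < j, n + 1 + 1 + i ∉ m) := by
  rw [genSum_split, tsum_eq_zero_add' ENNReal.summable]
  congr 1
  · rw [pow_zero, one_mul]
    refine genSum_congr fun m hm => ?_
    rw [Multiset.replicate_zero, zero_add]
    exact ⟨fun h => h.1, fun h => ⟨h, 0, by omega, fun h' => (hm _ h').false⟩⟩
  · have hcongr : ∀ c : ℕ, genSum (ENNReal.ofReal r) (n + 1) (fun m =>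
        ¬ (Multiset.replicate (c + 1) (n + 1) + m).HasRun k ∧
          ∃ i < j + 1, n + 1 + i ∉ Multiset.replicate (c + 1) (n + 1) + m)
        = genSum (ENNReal.ofReal r) (n + 1)
            (fun m => ¬ m.HasRun k ∧ ∃ i < j, n + 1 + 1 + i ∉ m) := by
      intro c
      refine genSum_congr fun m hm => ?_
      have hmem : ∀ a, a ∈ Multiset.replicate (c + 1) (n + 1) + m ↔ a = n + 1 ∨ a ∈ m := by
        intro a
        rw [Multiset.mem_add, Multiset.mem_replicate]
        simp
      simp only [Multiset.HasRun, hmem]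
      constructor
      · rintro ⟨h1, i, hi, h2⟩
        push Not at h2
        refine ⟨fun ⟨a, ha⟩ => h1 ⟨a, fun l hl => Or.inr (ha l hl)⟩, i - 1, by omega, ?_⟩
        rw [show n + 1 + 1 + (i - 1) = n + 1 + i by omega]
        exact h2.2
      · rintro ⟨h1, i, hi, h2⟩
        refine ⟨fun ⟨a, ha⟩ => ?_, i + 1, by omega, ?_⟩
        · have h0 := ha 0 (by omega)
          rcases Nat.lt_or_ge (n + 1) a with hlt | hge
          · exact h1 ⟨a, fun l hl => (ha l hl).resolve_left (by omega)⟩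
          · have ha1 : a = n + 1 := by
              rcases h0 with h0 | h0
              · omega
              · have := hm _ h0; omega
            subst ha1
            rcases ha (i + 1) (by omega) with h | h
            · omega
            · exact h2 (by rwa [show n + 1 + 1 + i = n + 1 + (i + 1) by omega])
        · push Not
          exact ⟨by omega, by rwa [show n + 1 + (i + 1) = n + 1 + 1 + i by omega]⟩
    rw [tsum_congr fun c => by rw [hcongr c, pow_succ, mul_assoc], ENNReal.tsum_mul_right,
      ENNReal.tsum_geometric, ennreal_inv_one_sub_pow hr0 hr1, ← mul_assoc]
    congr 1
    have h := one_sub_pow_pos hr0 hr1 n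
    rw [← ENNReal.ofReal_pow hr0.le, ← ENNReal.ofReal_mul (by positivity), partWeight,
      div_eq_mul_inv, mul_comm]

/-- Summation over the first size `n + 1 + i` that is missing: all of `n + 1, …, n + i` are present,
and the larger parts form a partition without run. -/
lemma genSum_run_unroll {r : ℝ} (hr0 : 0 < r) (hr1 : r < 1) {k : ℕ} (j : ℕ) (hj : j ≤ k) (n : ℕ) :
    genSum (ENNReal.ofReal r) n (fun m => ¬ m.HasRun k ∧ ∃ i < j, n + 1 + i ∉ m)
      = ∑ i ∈ Finset.range j, (∏ l ∈ Finset.range i, ENNReal.ofReal (partWeight r (n + 1 + l))) *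
        genSum (ENNReal.ofReal r) (n + 1 + i) (fun m => ¬ m.HasRun k) := by
  induction j generalizing n with
  | zero => simp [genSum]
  | succ j ih =>
    rw [genSum_run_step hr0 hr1 hj, ih (by omega), Finset.sum_range_succ', add_comm, Finset.mul_sum]
    congr 1
    · refine Finset.sum_congr rfl fun i _ => ?_
      rw [Finset.prod_range_succ', ← mul_assoc, mul_comm (ENNReal.ofReal _)]
      congr 2
      · refine Finset.prod_congr rfl fun l _ => ?_
        congr 2; omega
      · omega
    · simp

/-- With parts bounded by `L` the generating function is a finite product, bounded here by downward
induction on `n = L - i` through `1 / (1 - x) ≤ e^{x / (1 - x)}`. -/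
lemma genSum_truncated_le {r : ℝ} (hr0 : 0 < r) (hr1 : r < 1) (L : ℕ) :
    ∀ i n, n + i = L → genSum (ENNReal.ofReal r) n (fun m => ∀ a ∈ m, a ≤ L)
      ≤ ENNReal.ofReal (Real.exp (r ^ (n + 1) / (1 - r) ^ 2)) := by
  have h1r : 0 < 1 - r := by linarith
  intro i
  induction i with
  | zero =>
    rintro n rfl
    have h1 : (1 : ℝ≥0∞) ≤ ENNReal.ofReal (Real.exp (r ^ (n + 1) / (1 - r) ^ 2)) := by
      rw [ENNReal.one_le_ofReal]
      exact Real.one_le_exp (by positivity)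
    refine le_trans (le_of_eq ?_) h1
    unfold genSum
    rw [tsum_eq_single (⟨0, by simp⟩ : PartsAbove n)]
    · simp
    · rintro ⟨m, hm⟩ hne
      refine if_neg fun h => hne (Subtype.ext (Multiset.eq_zero_of_forall_notMem fun a ha => ?_))
      have h1 := hm a ha
      have h2 := h a ha
      simp only [add_zero] at h2
      omega
  | succ i ih =>
    intro n hn
    rw [genSum_split_of_iff, ennreal_inv_one_sub_pow hr0 hr1]
    · have hx := one_sub_pow_pos hr0 hr1 n
      refine (mul_le_mul_right (ih (n + 1) (by omega)) _).trans ?_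
      rw [← ENNReal.ofReal_mul (by positivity)]
      refine ENNReal.ofReal_le_ofReal ?_
      have hle : r ^ (n + 1) ≤ r := pow_le_of_le_one hr0.le hr1.le (Nat.succ_ne_zero n)
      have h2 : (1 - r ^ (n + 1))⁻¹ ≤ Real.exp (r ^ (n + 1) / (1 - r)) := by
        calc (1 - r ^ (n + 1))⁻¹ = r ^ (n + 1) / (1 - r ^ (n + 1)) + 1 := by field_simp; ring
          _ ≤ r ^ (n + 1) / (1 - r) + 1 := by gcongr
          _ ≤ _ := Real.add_one_le_exp _
      calc _ ≤ Real.exp (r ^ (n + 1) / (1 - r)) * Real.exp (r ^ (n + 1 + 1) / (1 - r) ^ 2) := by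
            gcongr
        _ = _ := by
            rw [← Real.exp_add]
            congr 1
            field_simp
            ring
    · intro c m
      constructor
      · exact fun h a ha => h a (Multiset.mem_add.2 (Or.inr ha))
      · intro h a ha
        rcases Multiset.mem_add.1 ha with h' | h'
        · rw [Multiset.eq_of_mem_replicate h']; omega
        · exact h a h'

/-- The explicit bound gives both convergence and the limit `1` as `n → ∞`. -/
lemma genSum_true_le {r : ℝ} (hr0 : 0 < r) (hr1 : r < 1) (n : ℕ) :
    genSum (ENNReal.ofReal r) n (fun _ => True)
      ≤ ENNReal.ofReal (Real.exp (r ^ (n + 1) / (1 - r) ^ 2)) := by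
  conv_lhs => unfold genSum
  rw [ENNReal.tsum_eq_iSup_sum]
  refine iSup_le fun F => ?_
  set L := n + F.sup fun m => m.1.sum with hL
  refine le_trans ?_ (genSum_truncated_le hr0 hr1 L (F.sup fun m => m.1.sum) n rfl)
  unfold genSum
  refine le_trans (Finset.sum_le_sum fun m hm => ?_) (ENNReal.sum_le_tsum F)
  rw [if_pos trivial, if_pos]
  intro a ha
  have h1 : a ≤ m.1.sum := Multiset.single_le_sum (fun _ _ => Nat.zero_le _) a ha
  have h2 : m.1.sum ≤ F.sup fun m => m.1.sum := Finset.le_sup (f := fun m : PartsAbove n => m.1.sum) hm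
  omega

/-- A partition of some number is the same as a multiset of positive integers. -/
def sigmaPartitionEquiv : (Σ n : ℕ, n.Partition) ≃ PartsAbove 0 where
  toFun p := ⟨p.2.parts, fun _ hi => p.2.parts_pos hi⟩
  invFun m := ⟨m.1.sum, ⟨m.1, fun {_} hi => m.2 _ hi, rfl⟩⟩
  left_inv p := by
    obtain ⟨n, ⟨parts, hpos, rfl⟩⟩ := p
    rfl
  right_inv _ := rfl

lemma tsum_numPartitionsNoKSeq {r : ℝ} (hr0 : 0 < r) (k : ℕ) :
    ∑' n : ℕ, ENNReal.ofReal ((numPartitionsNoKSeq k n : ℝ) * r ^ n)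
      = genSum (ENNReal.ofReal r) 0 (fun m => ¬ m.HasRun k) := by
  classical
  unfold genSum
  rw [← sigmaPartitionEquiv.tsum_eq, ENNReal.tsum_sigma']
  refine tsum_congr fun n => ?_
  rw [tsum_fintype]
  trans ∑ p : n.Partition, if ¬ p.HasKSequence k then ENNReal.ofReal r ^ n else 0
  swap
  · refine Finset.sum_congr rfl fun p _ => ?_
    have hs : (sigmaPartitionEquiv ⟨n, p⟩).1.sum = n := p.parts_sum
    rw [hs]
    by_cases h : p.HasKSequence k
    · rw [if_neg (not_not.2 h)]
      exact (if_neg (not_not.2 h)).symm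
    · rw [if_pos h]
      exact (if_pos h).symm
  rw [← Finset.sum_filter, Finset.sum_const, nsmul_eq_mul,
    ENNReal.ofReal_mul (Nat.cast_nonneg _), ENNReal.ofReal_natCast, ENNReal.ofReal_pow hr0.le,
    numPartitionsNoKSeq, Nat.card_eq_fintype_card, Fintype.card_subtype]

/-! ### The normalised recurrence and the asymptotics -/

lemma partWeight_exp {s : ℝ} (hs : 0 < s) {n : ℕ} (hn : 1 ≤ n) :
    (Real.exp (n * s) - 1) * partWeight (Real.exp (-s)) n = 1 := by
  have h := exp_sub_one_pos hn hs
  have he : Real.exp (-s) ^ n = (Real.exp (n * s))⁻¹ := by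
    rw [← Real.exp_nat_mul, ← Real.exp_neg]; congr 1; ring
  have hp := Real.exp_pos (n * s)
  have h2 : 1 - (Real.exp (n * s))⁻¹ ≠ 0 := by
    have : (Real.exp (n * s))⁻¹ < 1 := inv_lt_one_of_one_lt₀ (by linarith)
    linarith
  rw [partWeight, he]
  field_simp

/-- The generating function of the partitions with all parts exceeding `n`. -/
noncomputable def tailGenFun (r : ℝ) (n : ℕ) : ℝ :=
  (genSum (ENNReal.ofReal r) n fun _ => True).toReal

/-- The generating function of the partitions with all parts exceeding `n` and without
`k`-sequence. -/
noncomputable def runFreeGenFun (k : ℕ) (r : ℝ) (n : ℕ) : ℝ :=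
  (genSum (ENNReal.ofReal r) n fun m => ¬ m.HasRun k).toReal

section
variable {r : ℝ}

lemma genSum_ne_top (hr0 : 0 < r) (hr1 : r < 1) (n : ℕ) (P : Multiset ℕ → Prop) :
    genSum (ENNReal.ofReal r) n P ≠ ∞ :=
  ((genSum_mono fun _ _ => trivial).trans_lt
    ((genSum_true_le hr0 hr1 n).trans_lt ENNReal.ofReal_lt_top)).ne

lemma toReal_genSum_mem_Icc (hr0 : 0 < r) (hr1 : r < 1) (n : ℕ) {P : Multiset ℕ → Prop}
    (hP : P 0) : (genSum (ENNReal.ofReal r) n P).toReal ∈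
      Set.Icc 1 (Real.exp (r ^ (n + 1) / (1 - r) ^ 2)) := by
  constructor
  · rw [← ENNReal.toReal_one]
    exact ENNReal.toReal_mono (genSum_ne_top hr0 hr1 n P) (one_le_genSum hP)
  · refine ENNReal.toReal_le_of_le_ofReal (Real.exp_pos _).le ?_
    exact (genSum_mono fun _ _ => trivial).trans (genSum_true_le hr0 hr1 n)

lemma tendsto_toReal_genSum (hr0 : 0 < r) (hr1 : r < 1) {P : Multiset ℕ → Prop} (hP : P 0) :
    Tendsto (fun n => (genSum (ENNReal.ofReal r) n P).toReal) atTop (𝓝 1) := by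
  have h : Tendsto (fun n : ℕ => Real.exp (r ^ (n + 1) / (1 - r) ^ 2)) atTop (𝓝 1) := by
    have h1 := (tendsto_add_atTop_iff_nat 1).2 (tendsto_pow_atTop_nhds_zero_of_lt_one hr0.le hr1)
    have h2 := (h1.div_const ((1 - r) ^ 2)).rexp
    rwa [zero_div, Real.exp_zero] at h2
  exact tendsto_of_tendsto_of_tendsto_of_le_of_le tendsto_const_nhds h
    (fun n => (toReal_genSum_mem_Icc hr0 hr1 n hP).1)
    fun n => (toReal_genSum_mem_Icc hr0 hr1 n hP).2

lemma not_hasRun_zero {k : ℕ} (hk : 1 ≤ k) : ¬ (0 : Multiset ℕ).HasRun k :=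
  fun ⟨_, h⟩ => Multiset.notMem_zero _ (h 0 hk)

lemma tailGenFun_zero (hr0 : 0 < r) (hr1 : r < 1) (n : ℕ) :
    tailGenFun r 0 = (∏ l ∈ Finset.range n, (1 - r ^ (l + 1))⁻¹) * tailGenFun r n := by
  induction n with
  | zero => simp
  | succ n ih =>
    have h : tailGenFun r n = (1 - r ^ (n + 1))⁻¹ * tailGenFun r (n + 1) := by
      have hpos := one_sub_pow_pos hr0 hr1 n
      unfold tailGenFun
      rw [genSum_split_of_iff _ _ _ fun _ _ => Iff.rfl, ENNReal.toReal_mul,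
        ennreal_inv_one_sub_pow hr0 hr1, ENNReal.toReal_ofReal (by positivity)]
    rw [ih, h, Finset.prod_range_succ]
    ring

lemma partWeight_nonneg (hr0 : 0 < r) (hr1 : r < 1) (n : ℕ) : 0 ≤ partWeight r n := by
  have : r ^ n ≤ 1 := pow_le_one₀ hr0.le hr1.le
  exact div_nonneg (by positivity) (by linarith)

lemma runFreeGenFun_eq_sum (hr0 : 0 < r) (hr1 : r < 1) (k n : ℕ) :
    runFreeGenFun k r n = ∑ i ∈ Finset.range k,
      (∏ l ∈ Finset.range i, partWeight r (n + 1 + l)) * runFreeGenFun k r (n + 1 + i) := by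
  have h := genSum_run_unroll hr0 hr1 k le_rfl n
  have h2 : genSum (ENNReal.ofReal r) n (fun m => ¬ m.HasRun k ∧ ∃ i < k, n + 1 + i ∉ m)
      = genSum (ENNReal.ofReal r) n (fun m => ¬ m.HasRun k) := by
    refine genSum_congr fun m _ => ⟨fun h => h.1, fun h => ⟨h, ?_⟩⟩
    by_contra hc
    push Not at hc
    exact h ⟨n + 1, hc⟩
  rw [h2] at h
  unfold runFreeGenFun
  rw [h, ENNReal.toReal_sum fun i _ => ENNReal.mul_ne_top
    (ENNReal.prod_ne_top fun _ _ => ENNReal.ofReal_ne_top) (genSum_ne_top hr0 hr1 _ _)]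
  refine Finset.sum_congr rfl fun i _ => ?_
  rw [ENNReal.toReal_mul, ENNReal.toReal_prod]
  congr 1
  exact Finset.prod_congr rfl fun l _ => ENNReal.toReal_ofReal (partWeight_nonneg hr0 hr1 _)

end

/-- Multiplying by the weights of all parts up to `n` and dividing by the full partition
generating function turns the recurrence for generating functions into the normalised one. -/
lemma isRecSol_of_partWeight {k : ℕ} {s : ℝ} (hs : 0 < s) {u : ℕ → ℝ} (hu : ∀ n, 0 ≤ u n)
    (hlim : Tendsto u atTop (𝓝 1))
    (hrec : ∀ n, u n = ∑ i ∈ Finset.range k,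
      (∏ l ∈ Finset.range i, partWeight (Real.exp (-s)) (n + 1 + l)) * u (n + 1 + i)) :
    IsRecSol k s fun n => u n * (∏ l ∈ Finset.range n, partWeight (Real.exp (-s)) (l + 1))
      / tailGenFun (Real.exp (-s)) 0 := by
  have hr0 := Real.exp_pos (-s)
  have hr1 : Real.exp (-s) < 1 := Real.exp_lt_one_iff.2 (by linarith)
  set r := Real.exp (-s) with hr
  have hz : ∀ n, 0 < tailGenFun r n := fun n =>
    one_pos.trans_le (toReal_genSum_mem_Icc hr0 hr1 n (P := fun _ => True) trivial).1
  refine ⟨fun n => ?_, fun n => ?_, ?_⟩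
  · exact div_nonneg (mul_nonneg (hu n)
      (Finset.prod_nonneg fun l _ => partWeight_nonneg hr0 hr1 _)) (hz 0).le
  · rw [hrec n, Finset.sum_mul, Finset.sum_div]
    refine Finset.sum_bij' (fun i _ => i + 1) (fun j _ => j - 1) ?_ ?_ ?_ ?_ ?_
    · intro i hi; simp only [Finset.mem_Icc, Finset.mem_range] at *; omega
    · intro i hi; simp only [Finset.mem_Icc, Finset.mem_range] at *; omega
    · intro i hi; simp
    · intro i hi; simp only [Finset.mem_Icc] at hi; omega
    · intro i hi
      have hw := partWeight_exp hs (n := n + (i + 1)) (by omega)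
      rw [← hr] at hw
      have hprod : ∏ l ∈ Finset.range (n + (i + 1)), partWeight r (l + 1)
          = (∏ l ∈ Finset.range n, partWeight r (l + 1))
            * (∏ l ∈ Finset.range i, partWeight r (n + 1 + l)) * partWeight r (n + (i + 1)) := by
        rw [← add_assoc, Finset.prod_range_succ, Finset.prod_range_add]
        congr 2
        refine Finset.prod_congr rfl fun l _ => ?_
        congr 1; omega
      rw [hprod, show n + 1 + i = n + (i + 1) by omega]
      linear_combination (-((∏ l ∈ Finset.range i, partWeight r (n + 1 + l)) * u (n + (i + 1))
        * (∏ l ∈ Finset.range n, partWeight r (l + 1)) / tailGenFun r 0)) * hw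
  · have hz1 : Tendsto (tailGenFun r) atTop (𝓝 1) :=
      tendsto_toReal_genSum hr0 hr1 (P := fun _ => True) trivial
    have h := hlim.div hz1 one_ne_zero
    rw [div_one] at h
    refine h.congr fun n => ?_
    have hexp : (∏ l ∈ Finset.range n, r ^ (l + 1)) * Real.exp (s * (n * (n + 1) / 2)) = 1 := by
      induction n with
      | zero => simp
      | succ n ih =>
        rw [Finset.prod_range_succ, hr, ← Real.exp_nat_mul, ← hr,
          show s * (((n + 1 : ℕ) : ℝ) * ((n + 1 : ℕ) + 1) / 2)
            = s * (n * (n + 1) / 2) + (n + 1 : ℕ) * s by push_cast; ring, Real.exp_add]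
        calc _ = ((∏ l ∈ Finset.range n, r ^ (l + 1)) * Real.exp (s * (n * (n + 1) / 2)))
              * (Real.exp ((n + 1 : ℕ) * -s) * Real.exp ((n + 1 : ℕ) * s)) := by ring
          _ = 1 := by
              rw [ih, one_mul, ← Real.exp_add, mul_neg, neg_add_cancel, Real.exp_zero]
    have hpw : ∏ l ∈ Finset.range n, partWeight r (l + 1)
        = (∏ l ∈ Finset.range n, r ^ (l + 1)) * ∏ l ∈ Finset.range n, (1 - r ^ (l + 1))⁻¹ := by
      rw [← Finset.prod_mul_distrib]
      rfl
    have hprod : 0 < ∏ l ∈ Finset.range n, (1 - r ^ (l + 1))⁻¹ :=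
      Finset.prod_pos fun l _ => inv_pos.2 (one_sub_pow_pos hr0 hr1 l)
    have hzn := hz n
    rw [tailGenFun_zero hr0 hr1 n, hpw, Pi.div_apply]
    set A := ∏ l ∈ Finset.range n, r ^ (l + 1)
    set B := ∏ l ∈ Finset.range n, (1 - r ^ (l + 1))⁻¹
    calc u n / tailGenFun r n = u n * (A * Real.exp (s * (n * (n + 1) / 2))) / tailGenFun r n := by
          rw [hexp, mul_one]
      _ = _ := by field_simp

lemma summable_numPartitionsNoKSeq {r : ℝ} (hr0 : 0 < r) (hr1 : r < 1) (k : ℕ) :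
    Summable fun n : ℕ => (numPartitionsNoKSeq k n : ℝ) * r ^ n := by
  have h := tsum_numPartitionsNoKSeq hr0 k
  have h2 := ENNReal.summable_toReal (h ▸ genSum_ne_top hr0 hr1 0 _)
  refine h2.congr fun n => ENNReal.toReal_ofReal (by positivity)

lemma genFunNoKSeq_eq {r : ℝ} (hr0 : 0 < r) (hr1 : r < 1) (k : ℕ) :
    genFunNoKSeq k r = runFreeGenFun k r 0 := by
  have h := tsum_numPartitionsNoKSeq hr0 k
  unfold runFreeGenFun genFunNoKSeq
  rw [← h, ← ENNReal.ofReal_tsum_of_nonneg (fun n => by positivity)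
    (summable_numPartitionsNoKSeq hr0 hr1 k), ENNReal.toReal_ofReal]
  exact tsum_nonneg fun n => by positivity

theorem mainTheorem2 (k : ℕ) (hk : 2 ≤ k) :
    (∀ s : ℝ, 0 < s →
      Summable (fun n : ℕ => (numPartitionsNoKSeq k n : ℝ) * Real.exp (-s) ^ n)) ∧
    ∃ E : ℝ → ℝ,
      E =O[𝓝[>] (0 : ℝ)] (fun s : ℝ => s ^ (1 / (2 * (k : ℝ) + 3))) ∧
      ∀ s : ℝ, 0 < s →
        genFunNoKSeq k (Real.exp (-s)) =
          1 / (k : ℝ) *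
            Real.exp (Real.pi ^ 2 / (6 * s) * (1 - 2 / ((k : ℝ) * ((k : ℝ) + 1))) + E s) := by
  have hk1 : 1 ≤ k := by omega
  have hkp : (2 : ℝ) ≤ k := by exact_mod_cast hk
  have hr1 : ∀ s : ℝ, 0 < s → Real.exp (-s) < 1 := fun s hs =>
    Real.exp_lt_one_iff.2 (by linarith)
  have hGpos : ∀ s : ℝ, 0 < s → 0 < runFreeGenFun k (Real.exp (-s)) 0 := fun s hs =>
    one_pos.trans_le (toReal_genSum_mem_Icc (Real.exp_pos _) (hr1 s hs) 0
      (P := fun m => ¬ m.HasRun k) (not_hasRun_zero hk1)).1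
  refine ⟨fun s hs => summable_numPartitionsNoKSeq (Real.exp_pos _) (hr1 s hs) k,
    fun s => Real.log (k * genFunNoKSeq k (Real.exp (-s)))
      - Real.pi ^ 2 / (6 * s) * (1 - 2 / ((k : ℝ) * ((k : ℝ) + 1))), ?_, fun s hs => ?_⟩
  · obtain ⟨C1, hC1, h1⟩ := IsRecSol.log_zero hk1
    obtain ⟨C2, hC2, h2⟩ := IsRecSol.log_zero (k := 1) le_rfl
    refine IsBigO.of_bound (C1 + C2) ?_
    filter_upwards [h1, h2, self_mem_nhdsWithin,
      (eventually_le_nhds (show (0 : ℝ) < 1 by norm_num)).filter_mono nhdsWithin_le_nhds]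
      with s h1 h2 hs hs1
    have hs : 0 < s := hs
    have hr0 := Real.exp_pos (-s)
    have hr1 := hr1 s hs
    have hG := hGpos s hs
    have hz : 0 < tailGenFun (Real.exp (-s)) 0 :=
      one_pos.trans_le (toReal_genSum_mem_Icc hr0 hr1 0 (P := fun _ => True) trivial).1
    -- the partitions without `k`-sequence, and the empty partition as the case `k = 1`
    obtain ⟨-, b1⟩ := h1 _ (isRecSol_of_partWeight hs (u := runFreeGenFun k (Real.exp (-s)))
      (fun n => ENNReal.toReal_nonneg)
      (tendsto_toReal_genSum hr0 hr1 (P := fun m => ¬ m.HasRun k) (not_hasRun_zero hk1))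
      (runFreeGenFun_eq_sum hr0 hr1 k))
    obtain ⟨-, b2⟩ := h2 _ (isRecSol_of_partWeight hs (u := fun _ => 1)
      (fun n => zero_le_one) tendsto_const_nhds (fun n => by simp))
    simp only [Finset.range_zero, Finset.prod_empty, mul_one, Nat.cast_one, Real.log_one] at b1 b2
    rw [Real.log_div hG.ne' hz.ne'] at b1
    rw [Real.log_div one_ne_zero hz.ne', Real.log_one] at b2
    have hpow : s ^ (1 / (2 * (1 : ℝ) + 3)) ≤ s ^ (1 / (2 * (k : ℝ) + 3)) := by
      refine Real.rpow_le_rpow_of_exponent_ge hs hs1 ?_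
      exact one_div_le_one_div_of_le (by norm_num) (by linarith)
    simp only [mul_one] at hpow
    have hb2 : C2 * s ^ (1 / (2 + 3 : ℝ)) ≤ C2 * s ^ (1 / (2 * (k : ℝ) + 3)) := by gcongr
    have e1 : Real.pi ^ 2 / (6 * s) * (1 - 2 / ((k : ℝ) * ((k : ℝ) + 1)))
        = -(Real.pi ^ 2 / (3 * (k * (k + 1)))) / s - -(Real.pi ^ 2 / (3 * (1 + 1))) / s := by
      field_simp
      ring
    rw [Real.norm_eq_abs, Real.norm_of_nonneg (by positivity), genFunNoKSeq_eq hr0 hr1,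
      Real.log_mul (by positivity) hG.ne', e1]
    rw [abs_le] at b1 b2 ⊢
    constructor <;> linarith [b1.1, b1.2, b2.1, b2.2]
  · have hG := hGpos s hs
    rw [add_sub_cancel, genFunNoKSeq_eq (Real.exp_pos _) (hr1 s hs), Real.exp_log (by positivity)]
    field_simp
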